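/- Throughout, "cube" means a cube $Q\subset\mathbb R^n$ ($n\ge 1$) of positive side length with sides parallel to the coordinate axes, $\frac{1}{|Q|}\int_Q$ is the Lebesgue average, and a weight is a nonnegative, a.e. finite measurable function on $\mathbb R^n$; for a weight $w$ write $w(E)=\int_E w\,dx$. For $1<p<\infty$ put $p'=p/(p-1)$. For weights $v,w$ put $$[v,w]_{A_p}:=\sup_Q\Big(\frac1{|Q|}\int_Q v\,dx\Big)\Big(\frac1{|Q|}\int_Q w^{1-p'}\,dx\Big)^{p-1},$$ and write $(v,w)\in A_p$ if this is finite. An a.e. positive weight $u$ belongs to $A_\infty$ if $[u,u]_{A_s}<\infty$ for some $s\in(1,\infty)$. With the Hardy–Littlewood maximal operator $Mf(x)=\sup_{Q\ni x}\frac1{|Q|}\int_Q|f|\,dy$, put $$[u]_{A_\infty}:=\sup_Q\frac1{u(Q)}\int_Q M(u\chi_Q)\,dx .$$ For $p\in(1,\infty)$ and a measurable $f$ let $$\|f\|_{L^{p,q}(w)}:=\Big(p\int_0^\infty s^q\,w(\{|f|>s\})^{q/p}\,\frac{ds}{s}\Big)^{1/q}\ (0<q<\infty),\qquad \|f\|_{L^{p,\infty}(w)}:=\sup_{s>0}s\,w(\{|f|>s\})^{1/p},$$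 and let $\|M\|_{L^{p,q}(w)\to L^{p,q}(v)}$ be the supremum of $\|Mf\|_{L^{p,q}(v)}/\|f\|_{L^{p,q}(w)}$ over all measurable $f$ with $0<\|f\|_{L^{p,q}(w)}<\infty$. **Corollary.** There are an absolute constant $C>0$ and, for every $n\ge1$, a constant $c_n\ge1$ depending only on $n$, such that the following holds for all $n\ge 1$, $p\in(1,\infty)$ and $q\in(0,\infty]$. Let $v,w$ be weights on $\mathbb R^n$ with $(v,w)\in A_p$ and $\sigma:=w^{1-p'}\in A_\infty$. Then $$\|M\|_{L^{p,q}(w)\to L^{p,q}(v)}\le C\cdot\begin{cases} c_n\,p'\,[v,w]_{A_p}^{1/p}\,[\sigma]_{A_\infty}^{1/p} & \text{if } p\le q\le\infty,\\[2pt] \big(\tfrac{4c_n}{q}\big)^{1/q}(p')^{1/q}\,[v,w]_{A_p}^{1/p}\,[\sigma]_{A_\infty}^{1/q} & \text{if } 0<q\le p.\end{cases}$$ -/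

import Mathlib

open scoped ENNReal
open MeasureTheory

namespace LorentzMaximal

/-- The closed cube in `ℝⁿ`, with sides parallel to the coordinate axes, lower corner `a` and side
length `l`. -/
def cube {n : ℕ} (a : Fin n → ℝ) (l : ℝ) : Set (Fin n → ℝ) :=
  {x | ∀ i, a i ≤ x i ∧ x i ≤ a i + l}

/-- The average `|Q|⁻¹ ∫_Q g` of a nonnegative function. -/
noncomputable def avg {n : ℕ} (Q : Set (Fin n → ℝ)) (g : (Fin n → ℝ) → ℝ≥0∞) : ℝ≥0∞ :=
  (volume Q)⁻¹ * ∫⁻ x in Q, g x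

/-- The (uncentered) Hardy–Littlewood maximal function
`M f (x) = sup_{Q ∋ x} |Q|⁻¹ ∫_Q |f|`, the supremum being over all cubes containing `x`. -/
noncomputable def maximal {n : ℕ} {F : Type*} [ENorm F] (f : (Fin n → ℝ) → F)
    (x : Fin n → ℝ) : ℝ≥0∞ :=
  ⨆ (a : Fin n → ℝ) (l : ℝ) (_ : 0 < l) (_ : x ∈ cube a l), avg (cube a l) (fun y => ‖f y‖ₑ)

/-- Weights: nonnegative measurable functions that are finite almost everywhere. -/
def IsWeight {n : ℕ} (w : (Fin n → ℝ) → ℝ≥0∞) : Prop :=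
  AEMeasurable w volume ∧ ∀ᵐ x ∂volume, w x < ∞

/-- The dual weight `σ = w ^ (1 - p')`, where `p' = p / (p - 1)`. -/
noncomputable def dualWeight {n : ℕ} (p : ℝ) (w : (Fin n → ℝ) → ℝ≥0∞) : (Fin n → ℝ) → ℝ≥0∞ :=
  fun x => w x ^ (1 - p.conjExponent)

/-- The two-weight constant
`[v, w]_{A_p} = sup_Q (|Q|⁻¹ ∫_Q v) (|Q|⁻¹ ∫_Q w ^ (1 - p')) ^ (p - 1)`. -/
noncomputable def apConst {n : ℕ} (p : ℝ) (v w : (Fin n → ℝ) → ℝ≥0∞) : ℝ≥0∞ :=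
  ⨆ (a : Fin n → ℝ) (l : ℝ) (_ : 0 < l),
    avg (cube a l) v * avg (cube a l) (dualWeight p w) ^ (p - 1)

/-- The class `A_∞ = ⋃_{s > 1} A_s` of (almost everywhere positive) weights. -/
def MemAInfty {n : ℕ} (u : (Fin n → ℝ) → ℝ≥0∞) : Prop :=
  IsWeight u ∧ (∀ᵐ x ∂volume, 0 < u x) ∧ ∃ s : ℝ, 1 < s ∧ apConst s u u < ∞

/-- The Fujii–Wilson constant `[u]_{A_∞} = sup_Q u(Q)⁻¹ ∫_Q M(u χ_Q)`. -/
noncomputable def aInftyConst {n : ℕ} (u : (Fin n → ℝ) → ℝ≥0∞) : ℝ≥0∞ :=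
  ⨆ (a : Fin n → ℝ) (l : ℝ) (_ : 0 < l),
    (∫⁻ x in cube a l, u x)⁻¹ * ∫⁻ x in cube a l, maximal ((cube a l).indicator u) x

/-- The Lorentz (quasi-)norm of `L^{p,q}(w)`, through the distribution function
`s ↦ w {|f| > s}`:
`(p ∫_0^∞ s^q w{|f| > s}^{q/p} ds/s)^{1/q}` for `q < ∞`, and
`sup_{s > 0} s w{|f| > s}^{1/p}` for `q = ∞`. -/
noncomputable def lorentzNorm {n : ℕ} {F : Type*} [ENorm F] (p : ℝ) (q : ℝ≥0∞)
    (w : (Fin n → ℝ) → ℝ≥0∞) (f : (Fin n → ℝ) → F) : ℝ≥0∞ :=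
  if q = ∞ then
    ⨆ (s : ℝ) (_ : 0 < s),
      ENNReal.ofReal s * (volume.withDensity w {x | ENNReal.ofReal s < ‖f x‖ₑ}) ^ (1 / p)
  else
    (ENNReal.ofReal p * ∫⁻ s in Set.Ioi (0 : ℝ),
      ENNReal.ofReal s ^ q.toReal *
        (volume.withDensity w {x | ENNReal.ofReal s < ‖f x‖ₑ}) ^ (q.toReal / p) *
        (ENNReal.ofReal s)⁻¹) ^ (1 / q.toReal)

/-- The operator norm `‖M‖_{L^{p,q}(w) → L^{p,q}(v)}`: the supremum of
`‖M f‖_{L^{p,q}(v)} / ‖f‖_{L^{p,q}(w)}` over all nonzero `f` in `L^{p,q}(w)`. -/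
noncomputable def maximalOpNorm {n : ℕ} (p : ℝ) (q : ℝ≥0∞)
    (w v : (Fin n → ℝ) → ℝ≥0∞) : ℝ≥0∞ :=
  ⨆ (f : (Fin n → ℝ) → ℂ) (_ : AEMeasurable f volume) (_ : lorentzNorm p q w f ≠ 0)
    (_ : lorentzNorm p q w f ≠ ∞),
    lorentzNorm p q v (maximal f) / lorentzNorm p q w f

end LorentzMaximal

/-! The dual weight σ satisfies a reverse Hölder inequality with exponent 1 + δ, where 1/δ =
2(n+3)^n [σ]_{A_∞}. Put r = 1 + (p-1)/(1+δ) < p. Then w^{1-r'} = σ^{1+δ}, so the A_p condition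
self-improves to one of A_r type, and M has weak type (r,r) from w to v with constant controlled by
[v,w]_{A_p} (`weak_type_maximal`). Cutting f at height s/2 turns this into v{Mf > s} ≤ K ∫_0^∞ r
u^{r-1} w{|f| > (s/2) max(u,1)} du (`distribution_maximal_le`).

Only a one-dimensional Hardy inequality remains. The density r u^{r-1} max(u,1)^{-p} has mass
p/(p-r) = p'(1 + 1/δ), the source of p' and [σ]_{A_∞}. For q ≥ p Jensen's inequality gives this mass
the power 1/p; for q ≤ p Hardy's inequality for decreasing functions gives it the power 1/q.

The reverse Hölder inequality is proved on nested grids (`NestedGrid.reverse_holder`), and finitely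
many grids reach every cube (`exists_coveringGrid_cell`). The volume loss 6 of that covering must
not depend on n: it enters as 6^{r/p}, which the factor c_n^{1/q} could not absorb for large q ≤ p
if it were dimensional. The number of grids and the ratio (n+3)^n enter only with powers 1/p and
1/q, and go into c_n. -/

namespace LorentzMaximal

/-! ### Layer cake formula and scaling of integrals. -/

section LayerCake

lemma setLIntegral_Ioc_rpow {r a : ℝ} (hr : 0 < r) (ha : 0 ≤ a) :
    ∫⁻ t in Set.Ioc 0 a, ENNReal.ofReal (r * t ^ (r - 1)) = ENNReal.ofReal a ^ r := by
  have hint : IntervalIntegrable (fun t : ℝ => r * t ^ (r - 1)) volume 0 a :=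
    (intervalIntegral.intervalIntegrable_rpow' (by linarith)).const_mul r
  rw [← ofReal_integral_eq_lintegral_ofReal]
  · rw [← intervalIntegral.integral_of_le ha, intervalIntegral.integral_const_mul,
      integral_rpow (Or.inl (by linarith)), ENNReal.ofReal_rpow_of_nonneg ha hr.le]
    congr 1
    rw [sub_add_cancel, Real.zero_rpow hr.ne']
    field_simp
    ring
  · exact (intervalIntegrable_iff_integrableOn_Ioc_of_le ha).1 hint
  · filter_upwards [ae_restrict_mem measurableSet_Ioc] with t ht
    have := Real.rpow_nonneg ht.1.le (r - 1)
    positivity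

lemma setLIntegral_Ioi_one_rpow {r p : ℝ} (hr : 0 < r) (hrp : r < p) :
    ∫⁻ t in Set.Ioi (1 : ℝ), ENNReal.ofReal (r * t ^ (r - 1 - p)) =
      ENNReal.ofReal (r / (p - r)) := by
  rw [← ofReal_integral_eq_lintegral_ofReal]
  · rw [integral_const_mul, integral_Ioi_rpow_of_lt (by linarith) one_pos]
    congr 1
    rw [Real.one_rpow, show r - 1 - p + 1 = -(p - r) by ring, neg_div_neg_eq]
    ring
  · exact (integrableOn_Ioi_rpow_of_lt (by linarith) one_pos).const_mul r
  · filter_upwards [ae_restrict_mem measurableSet_Ioi] with t ht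
    have := Real.rpow_nonneg (zero_le_one.trans (le_of_lt ht)) (r - 1 - p)
    positivity

lemma rpow_eq_lintegral_indicator {r : ℝ} (hr : 0 < r) (a : ℝ≥0∞) :
    a ^ r = ∫⁻ t in Set.Ioi (0 : ℝ),
      ENNReal.ofReal (r * t ^ (r - 1)) * {t : ℝ | ENNReal.ofReal t < a}.indicator 1 t := by
  have key : ∀ b : ℝ, 0 ≤ b → ∫⁻ t in Set.Ioi (0 : ℝ), ENNReal.ofReal (r * t ^ (r - 1)) *
      (Set.Iio b).indicator 1 t = ENNReal.ofReal b ^ r := by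
    intro b hb
    have h1 : ∀ t : ℝ, ENNReal.ofReal (r * t ^ (r - 1)) * (Set.Iio b).indicator 1 t =
        (Set.Iio b).indicator (fun t => ENNReal.ofReal (r * t ^ (r - 1))) t := by
      intro t
      by_cases ht : t ∈ Set.Iio b <;> simp [ht]
    simp_rw [h1]
    rw [lintegral_indicator measurableSet_Iio, Measure.restrict_restrict measurableSet_Iio,
      Set.inter_comm, Set.Ioi_inter_Iio, setLIntegral_congr Ioo_ae_eq_Ioc,
      setLIntegral_Ioc_rpow hr hb]
  rcases eq_or_ne a ∞ with rfl | ha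
  · rw [ENNReal.top_rpow_of_pos hr]
    symm
    refine ENNReal.eq_top_of_forall_nnreal_le fun c => ?_
    -- For a = ∞ the integral dominates the one over t < c^{1/r}, which equals c, for every finite
    -- c.
    have h := key ((c : ℝ) ^ r⁻¹) (by positivity)
    rw [ENNReal.ofReal_rpow_of_nonneg (by positivity) hr.le, Real.rpow_inv_rpow c.coe_nonneg hr.ne',
      ENNReal.ofReal_coe_nnreal] at h
    rw [← h]
    refine lintegral_mono fun t => mul_le_mul_right ?_ _
    refine Set.indicator_le_indicator_of_subset (fun t _ => ?_) (fun _ => zero_le) t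
    simp
  · rw [← ENNReal.ofReal_toReal ha, ← key _ ENNReal.toReal_nonneg]
    refine setLIntegral_congr_fun measurableSet_Ioi fun t ht => ?_
    have : t ∈ Set.Iio a.toReal ↔ ENNReal.ofReal t < ENNReal.ofReal a.toReal := by
      rw [ENNReal.ofReal_lt_ofReal_iff_of_nonneg (le_of_lt ht), Set.mem_Iio]
    by_cases h : t ∈ Set.Iio a.toReal
    · simp [Set.indicator_of_mem h, this.1 h]
    · simp [Set.indicator_of_notMem h, not_lt.1 (mt this.2 h)]

/-- The layer cake formula for extended nonnegative functions. -/
theorem lintegral_rpow_eq_lintegral_superlevel {α : Type*} [MeasurableSpace α] (μ : Measure α)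
    [SFinite μ] {g : α → ℝ≥0∞} (hg : Measurable g) {r : ℝ} (hr : 0 < r) :
    ∫⁻ x, g x ^ r ∂μ = ∫⁻ t in Set.Ioi (0 : ℝ),
      ENNReal.ofReal (r * t ^ (r - 1)) * μ {x | ENNReal.ofReal t < g x} := by
  have hms : MeasurableSet {z : α × ℝ | ENNReal.ofReal z.2 < g z.1} :=
    measurableSet_lt (by fun_prop) (by fun_prop)
  have hm : Measurable fun z : α × ℝ => ENNReal.ofReal (r * z.2 ^ (r - 1)) *
      {z : α × ℝ | ENNReal.ofReal z.2 < g z.1}.indicator 1 z :=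
    Measurable.mul (by fun_prop) (measurable_one.indicator hms)
  simp_rw [rpow_eq_lintegral_indicator hr (g _)]
  rw [lintegral_lintegral_swap]
  · refine lintegral_congr fun t => ?_
    rw [lintegral_const_mul']
    · congr 1
      rw [← lintegral_indicator_one (measurableSet_lt measurable_const hg)]
      rfl
    · exact ENNReal.ofReal_ne_top
  · exact hm.aemeasurable

/-- The intervals (0,1] and (1,∞) contribute 1 and r/(p-r). This mass carries the whole blow-up as r
tends to p. -/
lemma lintegral_rpow_mul_max_rpow {r p : ℝ} (hr : 0 < r) (hrp : r < p) :
    ∫⁻ u in Set.Ioi (0 : ℝ), ENNReal.ofReal (r * u ^ (r - 1)) * ENNReal.ofReal (max u 1) ^ (-p) =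
      ENNReal.ofReal (p / (p - r)) := by
  rw [← Set.Ioc_union_Ioi_eq_Ioi (zero_le_one' ℝ),
    lintegral_union measurableSet_Ioi (Set.Ioc_disjoint_Ioi le_rfl)]
  have h1 : ∫⁻ u in Set.Ioc (0 : ℝ) 1, ENNReal.ofReal (r * u ^ (r - 1)) *
      ENNReal.ofReal (max u 1) ^ (-p) = 1 := by
    rw [← ENNReal.one_rpow r, ← ENNReal.ofReal_one, ← setLIntegral_Ioc_rpow hr zero_le_one]
    refine setLIntegral_congr_fun measurableSet_Ioc fun u hu => ?_
    simp [max_eq_right hu.2]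
  have h2 : ∫⁻ u in Set.Ioi (1 : ℝ), ENNReal.ofReal (r * u ^ (r - 1)) *
      ENNReal.ofReal (max u 1) ^ (-p) = ENNReal.ofReal (r / (p - r)) := by
    rw [← setLIntegral_Ioi_one_rpow hr hrp]
    refine setLIntegral_congr_fun measurableSet_Ioi fun u hu => ?_
    have hu0 : (0 : ℝ) < u := zero_lt_one.trans hu
    rw [max_eq_left (le_of_lt hu), ENNReal.ofReal_rpow_of_pos hu0,
      ← ENNReal.ofReal_mul (by positivity), mul_assoc, ← Real.rpow_add hu0, sub_eq_add_neg _ p]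
  rw [h1, h2, ← ENNReal.ofReal_one, ← ENNReal.ofReal_add zero_le_one
    (div_nonneg hr.le (by linarith))]
  congr 1
  have : p - r ≠ 0 := by linarith
  field_simp
  ring

lemma setLIntegral_Ioi_comp_mul {c : ℝ} (hc : 0 < c) {φ : ℝ → ℝ≥0∞} (hφ : Measurable φ) :
    ∫⁻ s in Set.Ioi (0 : ℝ), φ (c * s) = ENNReal.ofReal c⁻¹ * ∫⁻ s in Set.Ioi (0 : ℝ), φ s := by
  have h := Real.map_volume_mul_left hc.ne'
  have h2 : ∫⁻ s in Set.Ioi (0 : ℝ), φ s ∂(Measure.map (c * ·) volume) =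
      ∫⁻ s in Set.Ioi (0 : ℝ), φ (c * s) := by
    rw [setLIntegral_map measurableSet_Ioi hφ (by fun_prop)]
    congr 2
    ext s
    simp [hc]
  rw [← h2, h, Measure.restrict_smul, lintegral_smul_measure, abs_of_pos (inv_pos.2 hc)]
  rfl

/-- Scaling of the integrals that define the Lorentz norms. -/
lemma lintegral_rpow_scale {c q : ℝ} (hc : 0 < c) {φ : ℝ → ℝ≥0∞} (hφ : Measurable φ) :
    ∫⁻ s in Set.Ioi (0 : ℝ), ENNReal.ofReal s ^ q * φ (c * s) * (ENNReal.ofReal s)⁻¹ =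
      ENNReal.ofReal c ^ (-q) *
        ∫⁻ s in Set.Ioi (0 : ℝ), ENNReal.ofReal s ^ q * φ s * (ENNReal.ofReal s)⁻¹ := by
  have hm : Measurable fun s : ℝ => ENNReal.ofReal s ^ q * φ s * (ENNReal.ofReal s)⁻¹ := by
    fun_prop
  have hc0 : ENNReal.ofReal c ≠ 0 := by simpa using hc
  have key := setLIntegral_Ioi_comp_mul hc hm
  have h : ∫⁻ s in Set.Ioi (0 : ℝ),
      ENNReal.ofReal (c * s) ^ q * φ (c * s) * (ENNReal.ofReal (c * s))⁻¹ =
      (ENNReal.ofReal c ^ q * (ENNReal.ofReal c)⁻¹) * ∫⁻ s in Set.Ioi (0 : ℝ),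
        ENNReal.ofReal s ^ q * φ (c * s) * (ENNReal.ofReal s)⁻¹ := by
    rw [← lintegral_const_mul _ (by fun_prop)]
    refine setLIntegral_congr_fun measurableSet_Ioi fun s hs => ?_
    have hs0 : ENNReal.ofReal s ≠ 0 := by simpa using hs
    rw [ENNReal.ofReal_mul hc.le, ENNReal.mul_rpow_of_ne_top ENNReal.ofReal_ne_top
      ENNReal.ofReal_ne_top, ENNReal.mul_inv (Or.inl hc0) (Or.inl ENNReal.ofReal_ne_top)]
    ring
  rw [h, ENNReal.ofReal_inv_of_pos hc, mul_comm (ENNReal.ofReal c ^ q), mul_assoc] at key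
  have key2 := (ENNReal.mul_right_inj (ENNReal.inv_ne_zero.2 ENNReal.ofReal_ne_top)
    (ENNReal.inv_ne_top.2 hc0)).1 key
  rw [← key2, ← mul_assoc, ← ENNReal.rpow_add _ _ hc0 ENNReal.ofReal_ne_top]
  simp

end LayerCake

/-! ### Hardy-type inequalities for distribution functions. -/

section Hardy

/-- With x = 1/θ this is x ≤ 2^x. It keeps the constant in Hardy's inequality independent of θ =
q/p. -/
lemma rpow_neg_self_le_two {θ : ℝ} (hθ : 0 < θ) : (θ⁻¹) ^ θ ≤ 2 := by
  have h : θ⁻¹ ≤ 2 ^ θ⁻¹ := by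
    have h3 := one_add_mul_self_le_rpow_one_add (s := 1) (by norm_num) (p := θ⁻¹)
    rcases le_or_gt 1 θ⁻¹ with h1 | h1
    · have := h3 h1
      norm_num at this
      linarith
    · exact h1.le.trans (Real.one_le_rpow (by norm_num) (by positivity))
  calc (θ⁻¹) ^ θ ≤ (2 ^ θ⁻¹) ^ θ := Real.rpow_le_rpow (by positivity) h hθ.le
    _ = 2 := Real.rpow_inv_rpow (by norm_num) hθ.ne'

/-- Hardy's inequality for decreasing functions, with exponent at most one. -/
lemma rpow_lintegral_antitone_le {h : ℝ → ℝ≥0∞} (hanti : AntitoneOn h (Set.Ioi 0))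
    (hm : Measurable h) {r θ : ℝ} (hr : 0 < r) (hθ : 0 < θ) (hθ1 : θ ≤ 1) :
    (∫⁻ u in Set.Ioi (0 : ℝ), ENNReal.ofReal (r * u ^ (r - 1)) * h u) ^ θ ≤
      2 * ∫⁻ u in Set.Ioi (0 : ℝ), ENNReal.ofReal (r * θ * u ^ (r * θ - 1)) * h u ^ θ := by
  set S := ∫⁻ u in Set.Ioi (0 : ℝ), ENNReal.ofReal (r * θ * u ^ (r * θ - 1)) * h u ^ θ with hS
  rcases eq_or_ne S ∞ with hStop | hStop
  · simp [hStop]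
  -- On (0,u] the function h is at least h u, and the weight rθ t^{rθ-1} integrates to u^{rθ}.
  have hbound : ∀ u : ℝ, 0 < u → h u * ENNReal.ofReal u ^ r ≤ S ^ (1 / θ) := by
    intro u hu
    rw [one_div, ENNReal.le_rpow_inv_iff hθ, ENNReal.mul_rpow_of_nonneg _ _ hθ.le, ← ENNReal.rpow_mul,
      ← setLIntegral_Ioc_rpow (by positivity) hu.le, ← lintegral_const_mul _ (by fun_prop)]
    refine (setLIntegral_mono_ae (by fun_prop) ?_).trans
      (lintegral_mono_set Set.Ioc_subset_Ioi_self)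
    refine Filter.Eventually.of_forall fun t ht => ?_
    rw [mul_comm]
    exact mul_le_mul_right (ENNReal.rpow_le_rpow (hanti ht.1 hu ht.2) hθ.le) _
  -- Split h = h^{1-θ} h^θ and u^{r-1} = (u^r)^{1-θ} u^{rθ-1}; the factor (h u^r)^{1-θ} is
  -- controlled by `hbound`.
  have hpt : ∀ u ∈ Set.Ioi (0 : ℝ), ENNReal.ofReal (r * u ^ (r - 1)) * h u ≤
      (S ^ (1 / θ)) ^ (1 - θ) * ENNReal.ofReal θ⁻¹ *
        (ENNReal.ofReal (r * θ * u ^ (r * θ - 1)) * h u ^ θ) := by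
    intro u hu
    have hu : 0 < u := hu
    have e1 : ENNReal.ofReal (r * u ^ (r - 1)) = (ENNReal.ofReal u ^ r) ^ (1 - θ) *
        ENNReal.ofReal θ⁻¹ * ENNReal.ofReal (r * θ * u ^ (r * θ - 1)) := by
      rw [← ENNReal.rpow_mul, ENNReal.ofReal_rpow_of_pos hu, ← ENNReal.ofReal_mul (by positivity),
        ← ENNReal.ofReal_mul (by positivity)]
      congr 1
      rw [show r - 1 = r * (1 - θ) + (r * θ - 1) by ring, Real.rpow_add hu]
      field_simp
    have e2 : h u = h u ^ (1 - θ) * h u ^ θ := by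
      rw [← ENNReal.rpow_add_of_nonneg _ _ (by linarith) hθ.le]
      simp
    calc ENNReal.ofReal (r * u ^ (r - 1)) * h u
        = (h u * ENNReal.ofReal u ^ r) ^ (1 - θ) * ENNReal.ofReal θ⁻¹ *
          (ENNReal.ofReal (r * θ * u ^ (r * θ - 1)) * h u ^ θ) := by
          rw [e1, ENNReal.mul_rpow_of_nonneg _ _ (by linarith)]
          conv_lhs => rw [e2]
          ring
      _ ≤ _ := by
          have := ENNReal.rpow_le_rpow (hbound u hu) (sub_nonneg.2 hθ1)
          gcongr
  calc (∫⁻ u in Set.Ioi (0 : ℝ), ENNReal.ofReal (r * u ^ (r - 1)) * h u) ^ θ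
      ≤ ((S ^ (1 / θ)) ^ (1 - θ) * ENNReal.ofReal θ⁻¹ * S) ^ θ := by
        refine ENNReal.rpow_le_rpow ?_ hθ.le
        rw [hS, ← lintegral_const_mul _ (by fun_prop), ← hS]
        exact setLIntegral_mono (by fun_prop) hpt
    _ = ENNReal.ofReal ((θ⁻¹) ^ θ) * S := by
        rw [ENNReal.mul_rpow_of_nonneg _ _ hθ.le, ENNReal.mul_rpow_of_nonneg _ _ hθ.le,
          ← ENNReal.rpow_mul, ← ENNReal.rpow_mul,
          ENNReal.ofReal_rpow_of_nonneg (by positivity) hθ.le,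
          mul_comm (S ^ _), mul_assoc, ← ENNReal.rpow_add_of_nonneg _ _ _ hθ.le]
        · congr 1
          rw [show 1 / θ * ((1 - θ) * θ) + θ = 1 by field_simp; ring, ENNReal.rpow_one]
        · have : 0 ≤ 1 - θ := by linarith
          positivity
    _ ≤ 2 * S := by
        gcongr
        rw [← ENNReal.ofReal_ofNat]
        exact ENNReal.ofReal_le_ofReal (rpow_neg_self_le_two hθ)

/-- Jensen's inequality, with exponent at least one, for a density of finite mass. -/
lemma rpow_lintegral_le_of_one_le {α : Type*} [MeasurableSpace α] {μ : Measure α}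
    {θ : ℝ} (hθ : 1 ≤ θ) {d F : α → ℝ≥0∞} (hd : Measurable d) (hF : Measurable F) :
    (∫⁻ x, d x * F x ∂μ) ^ θ ≤ (∫⁻ x, d x ∂μ) ^ (θ - 1) * ∫⁻ x, d x * F x ^ θ ∂μ := by
  rcases hθ.eq_or_lt with rfl | hθ1
  · simp
  have hpq : θ.HolderConjugate θ.conjExponent := Real.HolderConjugate.conjExponent hθ1
  have hθ0 : 0 < θ := by linarith
  have h := ENNReal.lintegral_mul_le_Lp_mul_Lq (μ.withDensity d) hpq hF.aemeasurable
    (aemeasurable_const (b := (1 : ℝ≥0∞)))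
  simp only [Pi.mul_apply, mul_one, ENNReal.one_rpow] at h
  rw [lintegral_withDensity_eq_lintegral_mul _ hd hF,
    lintegral_withDensity_eq_lintegral_mul _ hd (by fun_prop),
    lintegral_withDensity_eq_lintegral_mul _ hd measurable_const] at h
  simp only [Pi.mul_apply, mul_one] at h
  refine (ENNReal.rpow_le_rpow h hθ0.le).trans (le_of_eq ?_)
  rw [ENNReal.mul_rpow_of_nonneg _ _ hθ0.le, ← ENNReal.rpow_mul, ← ENNReal.rpow_mul, mul_comm]
  congr 2
  · rw [Real.conjExponent]
    have : θ - 1 ≠ 0 := by linarith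
    field_simp
  · field_simp
    simp

variable {m V : ℝ → ℝ≥0∞} {K : ℝ≥0∞} {r p q : ℝ}

/-- Here `m` and `V` stand for the distribution functions of f and Mf. Inserting m(s) ≤ N^p s^{-p}
leaves exactly the mass p/(p-r). -/
lemma lorentz_hardy_top (hr : 0 < r) (hrp : r < p)
    (hV : ∀ s, 0 < s → V s ≤ K * ∫⁻ u in Set.Ioi (0 : ℝ),
      ENNReal.ofReal (r * u ^ (r - 1)) * m (s / 2 * max u 1)) :
    ⨆ (s : ℝ) (_ : 0 < s), ENNReal.ofReal s * V s ^ (1 / p) ≤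
      2 * (K * ENNReal.ofReal (p / (p - r))) ^ (1 / p) *
        ⨆ (s : ℝ) (_ : 0 < s), ENNReal.ofReal s * m s ^ (1 / p) := by
  have hp : 0 < p := hr.trans hrp
  set N := ⨆ (s : ℝ) (_ : 0 < s), ENNReal.ofReal s * m s ^ (1 / p) with hN
  have hmN : ∀ s : ℝ, 0 < s → m s ≤ N ^ p * ENNReal.ofReal s ^ (-p) := by
    intro s hs
    have h1 : ENNReal.ofReal s * m s ^ (1 / p) ≤ N :=
      le_iSup₂ (f := fun (s : ℝ) (_ : 0 < s) => ENNReal.ofReal s * m s ^ (1 / p)) s hs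
    have h2 := ENNReal.rpow_le_rpow h1 hp.le
    rw [ENNReal.mul_rpow_of_nonneg _ _ hp.le, ← ENNReal.rpow_mul, one_div_mul_cancel hp.ne',
      ENNReal.rpow_one] at h2
    rw [ENNReal.rpow_neg, ← div_eq_mul_inv, ENNReal.le_div_iff_mul_le, mul_comm]
    · exact h2
    · left
      simp [ENNReal.rpow_eq_zero_iff, hs]
    · left
      exact ENNReal.rpow_ne_top_of_nonneg hp.le ENNReal.ofReal_ne_top
  refine iSup₂_le fun s hs => ?_
  have h1 : V s ≤ K * (N ^ p * ENNReal.ofReal (s / 2) ^ (-p) * ENNReal.ofReal (p / (p - r))) := by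
    refine (hV s hs).trans ?_
    gcongr
    rw [← lintegral_rpow_mul_max_rpow hr hrp, ← lintegral_const_mul _ (by fun_prop)]
    refine setLIntegral_mono (by fun_prop) fun u _ => ?_
    have hmax : (0 : ℝ) < max u 1 := lt_max_of_lt_right one_pos
    calc _ ≤ ENNReal.ofReal (r * u ^ (r - 1)) *
          (N ^ p * ENNReal.ofReal (s / 2 * max u 1) ^ (-p)) := by
          gcongr
          exact hmN _ (by positivity)
      _ = _ := by
          rw [ENNReal.ofReal_mul (p := s / 2) (by positivity), ENNReal.mul_rpow_of_ne_top
            ENNReal.ofReal_ne_top ENNReal.ofReal_ne_top]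
          ring
  calc ENNReal.ofReal s * V s ^ (1 / p)
      ≤ ENNReal.ofReal s * (K * (N ^ p * ENNReal.ofReal (s / 2) ^ (-p) *
        ENNReal.ofReal (p / (p - r)))) ^ (1 / p) := by gcongr
    _ = ENNReal.ofReal s * (ENNReal.ofReal (s / 2))⁻¹ *
        (K * ENNReal.ofReal (p / (p - r))) ^ (1 / p) * N := by
        have hp1 : 0 ≤ 1 / p := by positivity
        simp only [ENNReal.mul_rpow_of_nonneg _ _ hp1, ← ENNReal.rpow_mul, neg_mul,
          mul_one_div_cancel hp.ne', ENNReal.rpow_one, ENNReal.rpow_neg_one]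
        ring
    _ = _ := by
        congr 2
        rw [← ENNReal.ofReal_inv_of_pos (by positivity), ← ENNReal.ofReal_mul hs.le,
          ← ENNReal.ofReal_ofNat]
        congr 1
        field_simp

/-- After Tonelli, dilating s by max(u,1)/2 for fixed u produces the factor 2^q max(u,1)^{-q}. -/
lemma lintegral_rpow_scaled_max (hm : Measurable m) {θ : ℝ} {d : ℝ → ℝ≥0∞}
    (hd : Measurable d) :
    ∫⁻ s in Set.Ioi (0 : ℝ), ENNReal.ofReal s ^ q *
        (∫⁻ u in Set.Ioi (0 : ℝ), d u * m (s / 2 * max u 1) ^ θ) * (ENNReal.ofReal s)⁻¹ =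
      2 ^ q * (∫⁻ u in Set.Ioi (0 : ℝ), d u * ENNReal.ofReal (max u 1) ^ (-q)) *
        ∫⁻ s in Set.Ioi (0 : ℝ), ENNReal.ofReal s ^ q * m s ^ θ * (ENNReal.ofReal s)⁻¹ := by
  set J := ∫⁻ s in Set.Ioi (0 : ℝ), ENNReal.ofReal s ^ q * m s ^ θ * (ENNReal.ofReal s)⁻¹
  have h1 : ∀ s : ℝ, ENNReal.ofReal s ^ q *
      (∫⁻ u in Set.Ioi (0 : ℝ), d u * m (s / 2 * max u 1) ^ θ) * (ENNReal.ofReal s)⁻¹ =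
      ∫⁻ u in Set.Ioi (0 : ℝ), d u * (ENNReal.ofReal s ^ q * m ((max u 1 / 2) * s) ^ θ *
        (ENNReal.ofReal s)⁻¹) := by
    intro s
    rw [← lintegral_const_mul _ (by fun_prop), ← lintegral_mul_const _ (by fun_prop)]
    refine lintegral_congr fun u => ?_
    rw [show s / 2 * max u 1 = (max u 1 / 2) * s by ring]
    ring
  simp_rw [h1]
  rw [lintegral_lintegral_swap (by fun_prop), mul_assoc, ← lintegral_mul_const J (by fun_prop),
    ← lintegral_const_mul (2 ^ q) (by fun_prop)]
  refine lintegral_congr fun u => ?_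
  have hmax : (0 : ℝ) < max u 1 := lt_max_of_lt_right one_pos
  rw [lintegral_const_mul _ (by fun_prop),
    lintegral_rpow_scale (φ := fun s => m s ^ θ) (by positivity) (by fun_prop),
    ENNReal.ofReal_div_of_pos two_pos, div_eq_mul_inv,
    ENNReal.mul_rpow_of_ne_top ENNReal.ofReal_ne_top (by simp), ENNReal.inv_rpow,
    ENNReal.rpow_neg (ENNReal.ofReal 2) q, inv_inv, ENNReal.ofReal_ofNat]
  ring

/-- Jensen is applied to max(u,1)^p m with the density d of mass Λ. The resulting max(u,1)^q cancels
against the scaling in s, so one more Λ appears and the total is Λ^{q/p}. -/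
lemma lorentz_hardy_of_le (hm : Measurable m) (hr : 0 < r) (hrp : r < p) (hpq : p ≤ q)
    (hV : ∀ s, 0 < s → V s ≤ K * ∫⁻ u in Set.Ioi (0 : ℝ),
      ENNReal.ofReal (r * u ^ (r - 1)) * m (s / 2 * max u 1)) :
    ∫⁻ s in Set.Ioi (0 : ℝ), ENNReal.ofReal s ^ q * V s ^ (q / p) * (ENNReal.ofReal s)⁻¹ ≤
      2 ^ q * (K * ENNReal.ofReal (p / (p - r))) ^ (q / p) *
        ∫⁻ s in Set.Ioi (0 : ℝ), ENNReal.ofReal s ^ q * m s ^ (q / p) *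
          (ENNReal.ofReal s)⁻¹ := by
  have hp : 0 < p := hr.trans hrp
  have hθ : 1 ≤ q / p := (one_le_div hp).2 hpq
  have hθ0 : 0 ≤ q / p := by linarith
  set Λ := ENNReal.ofReal (p / (p - r)) with hΛ
  set d : ℝ → ℝ≥0∞ := fun u => ENNReal.ofReal (r * u ^ (r - 1)) * ENNReal.ofReal (max u 1) ^ (-p)
    with hd
  have hdm : Measurable d := by fun_prop
  have hmax : ∀ u : ℝ, ENNReal.ofReal (max u 1) ≠ 0 := fun u => by simp
  have hdΛ : ∫⁻ u in Set.Ioi (0 : ℝ), d u = Λ := lintegral_rpow_mul_max_rpow hr hrp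
  have h1 : ∀ s : ℝ, 0 < s → V s ^ (q / p) ≤ K ^ (q / p) * Λ ^ (q / p - 1) *
      ∫⁻ u in Set.Ioi (0 : ℝ), (d u * ENNReal.ofReal (max u 1) ^ q) *
        m (s / 2 * max u 1) ^ (q / p) := by
    intro s hs
    have e : ∫⁻ u in Set.Ioi (0 : ℝ), ENNReal.ofReal (r * u ^ (r - 1)) * m (s / 2 * max u 1) =
        ∫⁻ u in Set.Ioi (0 : ℝ), d u * (ENNReal.ofReal (max u 1) ^ p * m (s / 2 * max u 1)) := by
      refine lintegral_congr fun u => ?_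
      rw [hd, ← mul_assoc, mul_assoc (ENNReal.ofReal (r * u ^ (r - 1))),
        ← ENNReal.rpow_add _ _ (hmax u) ENNReal.ofReal_ne_top]
      simp
    refine (ENNReal.rpow_le_rpow (hV s hs) hθ0).trans ?_
    rw [ENNReal.mul_rpow_of_nonneg _ _ hθ0, mul_assoc, e]
    gcongr
    refine (rpow_lintegral_le_of_one_le hθ hdm (by fun_prop)).trans (le_of_eq ?_)
    rw [hdΛ]
    congr 1
    refine lintegral_congr fun u => ?_
    rw [ENNReal.mul_rpow_of_nonneg _ _ hθ0, ← ENNReal.rpow_mul, mul_div_cancel₀ _ hp.ne',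
      ← mul_assoc]
  calc _ ≤ ∫⁻ s in Set.Ioi (0 : ℝ), K ^ (q / p) * Λ ^ (q / p - 1) * (ENNReal.ofReal s ^ q *
        (∫⁻ u in Set.Ioi (0 : ℝ), (d u * ENNReal.ofReal (max u 1) ^ q) *
          m (s / 2 * max u 1) ^ (q / p)) * (ENNReal.ofReal s)⁻¹) := by
        refine lintegral_mono_ae ?_
        filter_upwards [ae_restrict_mem measurableSet_Ioi] with s hs
        calc _ ≤ ENNReal.ofReal s ^ q * (K ^ (q / p) * Λ ^ (q / p - 1) *
              ∫⁻ u in Set.Ioi (0 : ℝ), (d u * ENNReal.ofReal (max u 1) ^ q) *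
                m (s / 2 * max u 1) ^ (q / p)) * (ENNReal.ofReal s)⁻¹ := by
              gcongr
              exact h1 s hs
          _ = _ := by ring
    _ = K ^ (q / p) * Λ ^ (q / p - 1) * (2 ^ q * Λ *
        ∫⁻ s in Set.Ioi (0 : ℝ), ENNReal.ofReal s ^ q * m s ^ (q / p) *
          (ENNReal.ofReal s)⁻¹) := by
        rw [lintegral_const_mul, lintegral_rpow_scaled_max hm (by fun_prop)]
        · congr 3
          rw [← hdΛ]
          refine lintegral_congr fun u => ?_
          rw [mul_assoc, ← ENNReal.rpow_add _ _ (hmax u) ENNReal.ofReal_ne_top]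
          simp
        · have : Measurable fun s : ℝ => ∫⁻ u in Set.Ioi (0 : ℝ),
              (d u * ENNReal.ofReal (max u 1) ^ q) * m (s / 2 * max u 1) ^ (q / p) :=
            Measurable.lintegral_prod_right' (f := fun z : ℝ × ℝ =>
              (d z.2 * ENNReal.ofReal (max z.2 1) ^ q) * m (z.1 / 2 * max z.2 1) ^ (q / p))
              (by fun_prop)
          fun_prop
    _ = _ := by
        have e : Λ ^ (q / p) = Λ ^ (q / p - 1) * Λ := by
          nth_rewrite 3 [← ENNReal.rpow_one Λ]
          rw [← ENNReal.rpow_add_of_nonneg _ _ (by linarith) zero_le_one, sub_add_cancel]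
        rw [ENNReal.mul_rpow_of_nonneg _ _ hθ0, e]
        ring

/-- Jensen goes the wrong way for q/p < 1, and monotonicity of m replaces it. The exponent r becomes
rq/p, whose mass q/(q - rq/p) is again p/(p-r), but now to the first power; hence 1/q after the
root. -/
lemma lorentz_hardy_of_ge (hanti : Antitone m) (hm : Measurable m) (hr : 0 < r) (hrp : r < p)
    (hq : 0 < q) (hqp : q ≤ p)
    (hV : ∀ s, 0 < s → V s ≤ K * ∫⁻ u in Set.Ioi (0 : ℝ),
      ENNReal.ofReal (r * u ^ (r - 1)) * m (s / 2 * max u 1)) :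
    ∫⁻ s in Set.Ioi (0 : ℝ), ENNReal.ofReal s ^ q * V s ^ (q / p) * (ENNReal.ofReal s)⁻¹ ≤
      2 ^ q * K ^ (q / p) * ENNReal.ofReal (2 * (p / (p - r))) *
        ∫⁻ s in Set.Ioi (0 : ℝ), ENNReal.ofReal s ^ q * m s ^ (q / p) *
          (ENNReal.ofReal s)⁻¹ := by
  have hp : 0 < p := hr.trans hrp
  have hθ : 0 < q / p := by positivity
  have hθ1 : q / p ≤ 1 := (div_le_one hp).2 hqp
  set d : ℝ → ℝ≥0∞ := fun u => ENNReal.ofReal (r * (q / p) * u ^ (r * (q / p) - 1)) with hd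
  have hdm : Measurable d := by fun_prop
  have hrq : r * (q / p) < q := by
    rw [← mul_div_assoc, div_lt_iff₀ hp, mul_comm]
    exact mul_lt_mul_of_pos_left hrp hq
  have h1 : ∀ s : ℝ, 0 < s → V s ^ (q / p) ≤ K ^ (q / p) * 2 *
      ∫⁻ u in Set.Ioi (0 : ℝ), d u * m (s / 2 * max u 1) ^ (q / p) := by
    intro s hs
    refine (ENNReal.rpow_le_rpow (hV s hs) hθ.le).trans ?_
    rw [ENNReal.mul_rpow_of_nonneg _ _ hθ.le, mul_assoc]
    gcongr
    refine rpow_lintegral_antitone_le (fun u _ t _ hut => hanti ?_) (by fun_prop) hr hθ hθ1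
    gcongr
  calc _ ≤ ∫⁻ s in Set.Ioi (0 : ℝ), K ^ (q / p) * 2 * (ENNReal.ofReal s ^ q *
        (∫⁻ u in Set.Ioi (0 : ℝ), d u * m (s / 2 * max u 1) ^ (q / p)) *
          (ENNReal.ofReal s)⁻¹) := by
        refine lintegral_mono_ae ?_
        filter_upwards [ae_restrict_mem measurableSet_Ioi] with s hs
        calc _ ≤ ENNReal.ofReal s ^ q * (K ^ (q / p) * 2 *
              ∫⁻ u in Set.Ioi (0 : ℝ), d u * m (s / 2 * max u 1) ^ (q / p)) *
                (ENNReal.ofReal s)⁻¹ := by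
              gcongr
              exact h1 s hs
          _ = _ := by ring
    _ = _ := by
        rw [lintegral_const_mul, lintegral_rpow_scaled_max hm hdm,
          lintegral_rpow_mul_max_rpow (by positivity) hrq,
          ENNReal.ofReal_mul zero_le_two, ENNReal.ofReal_ofNat,
          show q / (q - r * (q / p)) = p / (p - r) by
            have : p - r ≠ 0 := by linarith
            field_simp]
        · ring
        · have : Measurable fun s : ℝ => ∫⁻ u in Set.Ioi (0 : ℝ),
              d u * m (s / 2 * max u 1) ^ (q / p) :=
            Measurable.lintegral_prod_right' (f := fun z : ℝ × ℝ =>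
              d z.2 * m (z.1 / 2 * max z.2 1) ^ (q / p)) (by fun_prop)
          fun_prop

end Hardy

/-- A family of countable measurable partitions of `ℝⁿ`, indexed by `ℤ`, each of which refines
the next one. The cells of the `k`-th partition are the fibres of `idx k`. -/
structure NestedGrid (n : ℕ) where
  idx : ℤ → (Fin n → ℝ) → (Fin n → ℤ)
  measurable_idx : ∀ k, Measurable (idx k)
  nested : ∀ k x y, idx k x = idx k y → idx (k + 1) x = idx (k + 1) y

/-! ### Cells of nested grids and comparison of measures on maximal cells. -/

namespace NestedGrid

variable {n : ℕ} (D : NestedGrid n)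

/-- The cell of level `k` that contains `x`. -/
def cell (k : ℤ) (x : Fin n → ℝ) : Set (Fin n → ℝ) := {y | D.idx k y = D.idx k x}

lemma mem_cell_self (k : ℤ) (x : Fin n → ℝ) : x ∈ D.cell k x := rfl

lemma measurableSet_cell (k : ℤ) (x : Fin n → ℝ) : MeasurableSet (D.cell k x) :=
  D.measurable_idx k (measurableSet_singleton _)

variable {D}

lemma cell_congr {k : ℤ} {x y : Fin n → ℝ} (h : D.idx k x = D.idx k y) :
    D.cell k x = D.cell k y := by
  ext z
  simp [cell, h]

lemma idx_congr {k j : ℤ} (hkj : k ≤ j) {x y : Fin n → ℝ} (h : D.idx k x = D.idx k y) :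
    D.idx j x = D.idx j y := by
  induction j, hkj using Int.leInduction with
  | base => exact h
  | succ j _ ih => exact D.nested j x y ih

lemma cell_subset_cell {k j : ℤ} (hkj : k ≤ j) (x : Fin n → ℝ) : D.cell k x ⊆ D.cell j x :=
  fun _ hy => idx_congr hkj hy

lemma measurableSet_of_saturated {k : ℤ} {B : Set (Fin n → ℝ)}
    (hB : ∀ x y, D.idx k x = D.idx k y → x ∈ B → y ∈ B) : MeasurableSet B := by
  have : B = D.idx k ⁻¹' (D.idx k '' B) := by
    ext y
    constructor
    · exact fun hy => ⟨y, hy, rfl⟩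
    · rintro ⟨x, hx, hxy⟩
      exact hB x y hxy hx
  rw [this]
  exact D.measurable_idx k (Set.to_countable _).measurableSet

variable {μ ν : Measure (Fin n → ℝ)}

lemma measure_le_of_saturated {k : ℤ} {B : Set (Fin n → ℝ)}
    (hB : ∀ x y, D.idx k x = D.idx k y → x ∈ B → y ∈ B)
    (h : ∀ x ∈ B, μ (D.cell k x) ≤ ν (D.cell k x)) : μ B ≤ ν B := by
  have hBm : MeasurableSet B := measurableSet_of_saturated hB
  have hU : B = ⋃ i : Fin n → ℤ, B ∩ D.idx k ⁻¹' {i} := by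
    ext x
    simp
  have hle : ∀ i, μ (B ∩ D.idx k ⁻¹' {i}) ≤ ν (B ∩ D.idx k ⁻¹' {i}) := by
    intro i
    rcases (B ∩ D.idx k ⁻¹' {i}).eq_empty_or_nonempty with he | ⟨x, hxB, hxi⟩
    · simp [he]
    · have hxi : D.idx k x = i := hxi
      have : B ∩ D.idx k ⁻¹' {i} = D.cell k x := by
        ext y
        constructor
        · rintro ⟨_, hy⟩
          exact (show D.idx k y = i from hy).trans hxi.symm
        · intro hy
          exact ⟨hB x y (show D.idx k y = D.idx k x from hy).symm hxB,
            (show D.idx k y = D.idx k x from hy).trans hxi⟩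
      rw [this]
      exact h x hxB
  calc μ B ≤ ∑' i, μ (B ∩ D.idx k ⁻¹' {i}) := by
        conv_lhs => rw [hU]
        exact measure_iUnion_le _
    _ ≤ ∑' i, ν (B ∩ D.idx k ⁻¹' {i}) := ENNReal.tsum_le_tsum hle
    _ = ν B := by
        conv_rhs => rw [hU]
        rw [measure_iUnion]
        · intro i j hij
          refine Set.disjoint_left.2 ?_
          rintro x ⟨_, hi⟩ ⟨_, hj⟩
          exact hij ((show D.idx k x = i from hi).symm.trans hj)
        · exact fun i => hBm.inter (D.measurable_idx k (measurableSet_singleton _))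

/-- A comparison of measures on the maximal cells with a property `P` gives a comparison on the
union of all cells with that property. -/
lemma measure_le_of_maximal_cells {P : ℤ → (Fin n → ℝ) → Prop}
    (hP : ∀ k x y, D.idx k x = D.idx k y → P k x → P k y) (K : ℤ)
    (h : ∀ k ≤ K, ∀ x, P k x → (∀ j, k < j → j ≤ K → ¬ P j x) →
      μ (D.cell k x) ≤ ν (D.cell k x)) :
    μ {x | ∃ k ≤ K, P k x} ≤ ν {x | ∃ k ≤ K, P k x} := by
  -- `B k` holds the points whose coarsest cell with the property, among levels at most K, has level
  -- k; the bound K makes a coarsest one exist.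
  set B : ℤ → Set (Fin n → ℝ) := fun k => {x | k ≤ K ∧ P k x ∧ ∀ j, k < j → j ≤ K → ¬ P j x}
    with hBdef
  have hsat : ∀ k x y, D.idx k x = D.idx k y → x ∈ B k → y ∈ B k := by
    rintro k x y hxy ⟨hk, hx, hmax⟩
    exact ⟨hk, hP k x y hxy hx,
      fun j hj hjK hy => hmax j hj hjK (hP j y x (idx_congr hj.le hxy.symm) hy)⟩
  have hU : {x | ∃ k ≤ K, P k x} = ⋃ k, B k := by
    ext x
    simp only [Set.mem_ofPred_eq, Set.mem_iUnion]
    constructor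
    · rintro ⟨k, hk, hx⟩
      obtain ⟨m, ⟨hmK, hm⟩, hmax⟩ := Int.exists_greatest_of_bdd (P := fun k => k ≤ K ∧ P k x)
        ⟨K, fun z hz => hz.1⟩ ⟨k, hk, hx⟩
      exact ⟨m, hmK, hm, fun j hj hjK hjP => absurd (hmax j ⟨hjK, hjP⟩) (not_le.2 hj)⟩
    · rintro ⟨k, hk, hx, _⟩
      exact ⟨k, hk, hx⟩
  have hdisj : Pairwise (Function.onFun Disjoint B) := by
    intro i j hij
    refine Set.disjoint_left.2 ?_
    rintro x ⟨hi, hxi, hmi⟩ ⟨hj, hxj, hmj⟩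
    rcases lt_or_gt_of_ne hij with hlt | hlt
    · exact hmi j hlt hj hxj
    · exact hmj i hlt hi hxi
  rw [hU]
  calc μ (⋃ k, B k) ≤ ∑' k, μ (B k) := measure_iUnion_le _
    _ ≤ ∑' k, ν (B k) := ENNReal.tsum_le_tsum fun k =>
        measure_le_of_saturated (hsat k) fun x hx => h k hx.1 x hx.2.1 hx.2.2
    _ = ν (⋃ k, B k) := (measure_iUnion hdisj fun k => measurableSet_of_saturated (hsat k)).symm

/-- Cells with the property may grow without bound, so a maximal one need not exist. Levels are cut
at K, and then K tends to infinity. -/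
lemma measure_le_of_cells {P : ℤ → (Fin n → ℝ) → Prop}
    (hP : ∀ k x y, D.idx k x = D.idx k y → P k x → P k y)
    (h : ∀ k x, P k x → μ (D.cell k x) ≤ ν (D.cell k x)) :
    μ {x | ∃ k, P k x} ≤ ν {x | ∃ k, P k x} := by
  have hU : {x | ∃ k, P k x} = ⋃ K : ℕ, {x | ∃ k ≤ (K : ℤ), P k x} := by
    ext x
    simp only [Set.mem_ofPred_eq, Set.mem_iUnion]
    constructor
    · rintro ⟨k, hx⟩
      exact ⟨k.toNat, k, Int.self_le_toNat k, hx⟩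
    · rintro ⟨_, k, _, hx⟩
      exact ⟨k, hx⟩
  have hmono : Monotone fun K : ℕ => {x | ∃ k ≤ (K : ℤ), P k x} := by
    rintro K K' hK x ⟨k, hk, hx⟩
    exact ⟨k, hk.trans (by exact_mod_cast hK), hx⟩
  rw [hU, hmono.measure_iUnion, hmono.measure_iUnion]
  exact iSup_mono fun K => measure_le_of_maximal_cells hP K fun k _ x hx _ => h k x hx

variable (D)

/-- The maximal function over the cells of level at most `k`. -/
noncomputable def localMax (u : (Fin n → ℝ) → ℝ≥0∞) (k : ℤ) (x : Fin n → ℝ) : ℝ≥0∞ :=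
  ⨆ (j : ℤ) (_ : j ≤ k), avg (D.cell j x) u

lemma measurable_avg_cell (u : (Fin n → ℝ) → ℝ≥0∞) (k : ℤ) :
    Measurable fun x => avg (D.cell k x) u := by
  have : (fun x => avg (D.cell k x) u) =
      (fun i => avg {y | D.idx k y = i} u) ∘ D.idx k := rfl
  rw [this]
  exact (measurable_of_countable _).comp (D.measurable_idx k)

lemma measurable_localMax (u : (Fin n → ℝ) → ℝ≥0∞) (k : ℤ) : Measurable (D.localMax u k) :=
  .iSup fun j => .iSup fun _ => D.measurable_avg_cell u j

end NestedGrid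

/-- The hypothesis is integrated against δ t^{δ-1} dt. The last term would even carry δ/(1+δ); the
denominator is dropped. -/
lemma lintegral_rpow_le_of_superlevel {α : Type*} [MeasurableSpace α] {μ ν : Measure α}
    [SFinite μ] [SFinite ν] {f : α → ℝ≥0∞} (hf : Measurable f) {δ : ℝ} (hδ : 0 < δ)
    {a H c : ℝ≥0∞}
    (h : ∀ t : ℝ, 0 < t → μ {x | ENNReal.ofReal t < f x} ≤
      {t : ℝ | ENNReal.ofReal t < a}.indicator 1 t * H +
        c * ENNReal.ofReal t * ν {x | ENNReal.ofReal t < f x}) :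
    ∫⁻ x, f x ^ δ ∂μ ≤ a ^ δ * H + ENNReal.ofReal δ * c * ∫⁻ x, f x ^ (1 + δ) ∂ν := by
  have hm1 : Measurable fun t : ℝ => {t : ℝ | ENNReal.ofReal t < a}.indicator (1 : ℝ → ℝ≥0∞) t :=
    measurable_one.indicator (measurableSet_lt (by fun_prop) (by fun_prop))
  have hm2 : Measurable fun t : ℝ => ν {x | ENNReal.ofReal t < f x} := by
    have hanti : Antitone fun t : ℝ => ν {x | ENNReal.ofReal t < f x} := fun s t hst =>
      measure_mono fun x hx => lt_of_le_of_lt (ENNReal.ofReal_le_ofReal hst) hx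
    exact hanti.measurable
  have hδ1 : 0 < 1 + δ := by linarith
  have hd : Measurable fun t : ℝ => ENNReal.ofReal (δ * t ^ (δ - 1)) := by fun_prop
  have hd1 : Measurable fun t : ℝ => ENNReal.ofReal (δ * t ^ (δ - 1)) *
      {t : ℝ | ENNReal.ofReal t < a}.indicator (1 : ℝ → ℝ≥0∞) t := hd.mul hm1
  have hm3 : Measurable fun t : ℝ => ENNReal.ofReal ((1 + δ) * t ^ (1 + δ - 1)) *
      ν {x | ENNReal.ofReal t < f x} := Measurable.mul (by fun_prop) hm2
  rw [lintegral_rpow_eq_lintegral_superlevel μ hf hδ,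
    lintegral_rpow_eq_lintegral_superlevel ν hf hδ1, rpow_eq_lintegral_indicator hδ a,
    ← lintegral_mul_const _ hd1, ← lintegral_const_mul _ hm3,
    ← lintegral_add_left (hd1.mul_const H)]
  refine setLIntegral_mono ((hd1.mul_const H).add (hm3.const_mul _)) fun t ht => ?_
  have ht : 0 < t := ht
  calc _ ≤ ENNReal.ofReal (δ * t ^ (δ - 1)) * ({t : ℝ | ENNReal.ofReal t < a}.indicator 1 t * H +
        c * ENNReal.ofReal t * ν {x | ENNReal.ofReal t < f x}) := by
        gcongr
        exact h t ht
    _ = ENNReal.ofReal (δ * t ^ (δ - 1)) * {t : ℝ | ENNReal.ofReal t < a}.indicator 1 t * H +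
        ENNReal.ofReal δ * c * (ENNReal.ofReal (t ^ δ) * ν {x | ENNReal.ofReal t < f x}) := by
        have e : ENNReal.ofReal (t ^ δ) = ENNReal.ofReal (t ^ (δ - 1)) * ENNReal.ofReal t := by
          rw [← ENNReal.ofReal_mul (by positivity), Real.rpow_sub_one ht.ne',
            div_mul_cancel₀ _ ht.ne']
        rw [e, ENNReal.ofReal_mul hδ.le]
        ring
    _ ≤ _ := by
        gcongr
        rw [show 1 + δ - 1 = δ by ring]
        have := Real.rpow_nonneg ht.le δ
        nlinarith

/-! ### Reverse Hölder inequality on a grid. -/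

namespace NestedGrid

variable {n : ℕ} {D : NestedGrid n}

/-- The reverse Hölder inequality on the cells of a grid. -/
theorem reverse_holder {u : (Fin n → ℝ) → ℝ≥0∞} (hu : AEMeasurable u) {c A : ℝ≥0∞} {δ : ℝ}
    (hδ : 0 < δ) (hA : A ≠ ∞) (hδA : ENNReal.ofReal δ * (A * c) ≤ 2⁻¹)
    (hvol0 : ∀ k x, volume (D.cell k x) ≠ 0) (hvol : ∀ k x, volume (D.cell k x) ≠ ∞)
    (hdbl : ∀ k x, volume (D.cell (k + 1) x) ≤ c * volume (D.cell k x))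
    (hfin : ∀ k x, ∫⁻ y in D.cell k x, u y ≠ ∞)
    (hmax : ∀ k x, ∫⁻ y in D.cell k x, D.localMax u k y ≤ A * ∫⁻ y in D.cell k x, u y)
    (hdiff : ∀ k, ∀ᵐ y, u y ≤ D.localMax u k y) (K : ℤ) (x₀ : Fin n → ℝ) :
    ∫⁻ y in D.cell K x₀, u y ^ (1 + δ) ≤
      2 * avg (D.cell K x₀) u ^ δ * ∫⁻ y in D.cell K x₀, u y := by
  set I := D.cell K x₀ with hI
  have hIm : MeasurableSet I := D.measurableSet_cell K x₀
  set G := D.localMax u K with hG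
  have hGm : Measurable G := D.measurable_localMax u K
  set a := avg I u with ha
  set U := ∫⁻ y in I, u y with hU
  have havg : ∀ k x, ∫⁻ y in D.cell k x, u y = avg (D.cell k x) u * volume (D.cell k x) := by
    intro k x
    rw [avg, mul_comm, ← mul_assoc, ENNReal.mul_inv_cancel (hvol0 k x) (hvol k x), one_mul]
  -- comparison on the superlevel sets
  have hlevel : ∀ t : ℝ, ¬ ENNReal.ofReal t < a → ∀ (μ : Measure (Fin n → ℝ)) (b : ℝ≥0∞),
      (∀ k x, k ≤ K → x ∈ I → (∀ j, k < j → j ≤ K → avg (D.cell j x) u ≤ avg (D.cell k x) u) →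
        μ (D.cell k x) ≤ b * ∫⁻ y in D.cell k x, u y) →
      μ (I ∩ {x | ENNReal.ofReal t < G x}) ≤
        b * c * ENNReal.ofReal t * volume (I ∩ {x | ENNReal.ofReal t < G x}) := by
    intro t ht μ b hμ
    -- The bound k ≤ K is repeated inside the property because membership in I is constant only on
    -- cells of level at most K.
    have hset : I ∩ {x | ENNReal.ofReal t < G x} =
        {x | ∃ k ≤ K, x ∈ I ∧ k ≤ K ∧ ENNReal.ofReal t < avg (D.cell k x) u} := by
      ext x
      simp only [Set.mem_inter_iff, Set.mem_ofPred_eq, hG, localMax, lt_iSup_iff]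
      constructor
      · rintro ⟨hx, k, hk, h⟩
        exact ⟨k, hk, hx, hk, h⟩
      · rintro ⟨k, hk, hx, _, h⟩
        exact ⟨hx, k, hk, h⟩
    rw [hset]
    have := measure_le_of_maximal_cells (D := D) (μ := μ)
      (ν := (b * c * ENNReal.ofReal t) • volume)
      (P := fun k x => x ∈ I ∧ k ≤ K ∧ ENNReal.ofReal t < avg (D.cell k x) u) ?_ K ?_
    · simpa using this
    · rintro k x y hxy ⟨hx, hk, h⟩
      refine ⟨?_, hk, ?_⟩
      · exact (idx_congr hk hxy.symm).trans hx
      · rwa [← cell_congr hxy]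
    · rintro k hk x ⟨hx, _, h⟩ hnot
      -- A maximal cell is not I itself, whose average is at most t. So its parent has level at most
      -- K and average at most t, which bounds the mass of u on the cell by t c times its volume.
      have hlt : k < K := by
        refine lt_of_le_of_ne hk ?_
        rintro rfl
        exact ht (by rwa [ha, hI, ← cell_congr (show D.idx k x = D.idx k x₀ from hx)])
      have hle : ∀ j, k < j → j ≤ K → avg (D.cell j x) u ≤ ENNReal.ofReal t := fun j hj hjK =>
        not_lt.1 fun h' => hnot j hj hjK ⟨hx, hjK, h'⟩
      refine (hμ k x hk hx fun j hj hjK => (hle j hj hjK).trans h.le).trans ?_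
      rw [Measure.smul_apply, smul_eq_mul, mul_assoc b, mul_assoc b]
      gcongr
      calc ∫⁻ y in D.cell k x, u y ≤ ∫⁻ y in D.cell (k + 1) x, u y :=
            lintegral_mono_set (cell_subset_cell (by lia) x)
        _ = avg (D.cell (k + 1) x) u * volume (D.cell (k + 1) x) := havg _ _
        _ ≤ ENNReal.ofReal t * (c * volume (D.cell k x)) := by
            gcongr
            · exact hle (k + 1) (by lia) (by lia)
            · exact hdbl k x
        _ = _ := by ring
  -- Truncating G at height m makes the integral to be absorbed finite.
  have htrunc : ∀ (μ : Measure (Fin n → ℝ)) [SFinite μ] (b : ℝ≥0∞) (m : ℕ), μ I ≤ b * U →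
      (∀ k x, k ≤ K → x ∈ I → (∀ j, k < j → j ≤ K → avg (D.cell j x) u ≤ avg (D.cell k x) u) →
        μ (D.cell k x) ≤ b * ∫⁻ y in D.cell k x, u y) →
      ∫⁻ x in I, min (G x) m ^ δ ∂μ ≤
        a ^ δ * (b * U) + ENNReal.ofReal δ * (b * c) * ∫⁻ x in I, min (G x) m ^ (1 + δ) := by
    intro μ _ b m hμI hμ
    have hfm : Measurable fun x => min (G x) (m : ℝ≥0∞) := hGm.min measurable_const
    refine lintegral_rpow_le_of_superlevel hfm hδ fun t ht => ?_
    rw [Measure.restrict_apply (measurableSet_lt measurable_const hfm),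
      Measure.restrict_apply (measurableSet_lt measurable_const hfm)]
    by_cases htm : ENNReal.ofReal t < m
    · have e : {x | ENNReal.ofReal t < min (G x) (m : ℝ≥0∞)} = {x | ENNReal.ofReal t < G x} := by
        ext x
        simp [htm]
      rw [e, Set.inter_comm]
      by_cases hta : ENNReal.ofReal t < a
      · rw [Set.indicator_of_mem (by exact hta)]
        calc _ ≤ μ I := measure_mono Set.inter_subset_left
          _ ≤ b * U := hμI
          _ ≤ _ := by simp
      · exact (hlevel t hta μ b hμ).trans (by simp)
    · have e : {x | ENNReal.ofReal t < min (G x) (m : ℝ≥0∞)} = ∅ := by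
        ext x
        simpa using fun _ => not_lt.1 htm
      rw [e]
      simp
  -- the two applications
  have hUfin : U ≠ ∞ := hfin K x₀
  have haU : a ≠ ∞ := ENNReal.mul_ne_top (ENNReal.inv_ne_top.2 (hvol0 K x₀)) hUfin
  -- The measure G dx, with b = A: as δAc ≤ 1/2, the last term is absorbed on the left.
  have hX : ∀ m : ℕ, ∫⁻ x in I, min (G x) m ^ δ * G x ≤ 2 * (a ^ δ * (A * U)) := by
    intro m
    have hμI : (volume.withDensity G) I ≤ A * U := by
      rw [withDensity_apply _ hIm]
      exact hmax K x₀
    have h1 := htrunc (volume.withDensity G) A m hμI ?_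
    · rw [setLIntegral_withDensity_eq_setLIntegral_mul _ hGm
        ((hGm.min measurable_const).pow_const δ) hIm] at h1
      simp only [Pi.mul_apply, mul_comm (G _)] at h1
      set X := ∫⁻ x in I, min (G x) m ^ δ * G x with hXdef
      have hXfin : X ≠ ∞ := by
        refine ne_top_of_le_ne_top (b := (m : ℝ≥0∞) ^ δ * (A * U)) ?_ ?_
        · exact ENNReal.mul_ne_top (ENNReal.rpow_ne_top_of_nonneg hδ.le (by simp))
            (ENNReal.mul_ne_top hA hUfin)
        · calc X ≤ ∫⁻ x in I, (m : ℝ≥0∞) ^ δ * G x := by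
                refine lintegral_mono fun x => ?_
                gcongr
                exact min_le_right _ _
            _ = (m : ℝ≥0∞) ^ δ * ∫⁻ x in I, G x := lintegral_const_mul _ hGm
            _ ≤ _ := by
                gcongr
                exact hmax K x₀
      have h2 : ∫⁻ x in I, min (G x) m ^ (1 + δ) ≤ X := by
        refine lintegral_mono fun x => ?_
        rw [add_comm, ENNReal.rpow_add_of_nonneg _ _ hδ.le zero_le_one, ENNReal.rpow_one]
        gcongr
        exact min_le_left _ _
      have h3 : X ≤ a ^ δ * (A * U) + 2⁻¹ * X :=
        h1.trans (by gcongr)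
      have h4 : 2⁻¹ * X + 2⁻¹ * X = X := by
        rw [← add_mul, ENNReal.inv_two_add_inv_two, one_mul]
      have h5 : 2⁻¹ * X ≤ a ^ δ * (A * U) := by
        rw [← ENNReal.add_le_add_iff_right (a := 2⁻¹ * X)
          (ENNReal.mul_ne_top (by simp) hXfin), h4]
        exact h3
      calc X = 2 * (2⁻¹ * X) := by
            rw [← mul_assoc, ENNReal.mul_inv_cancel two_ne_zero (by simp), one_mul]
        _ ≤ _ := by gcongr
    -- On a cell whose average dominates those of its ancestors up to level K, G agrees with the
    -- local maximal function of level k, so `hmax` applies to that cell.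
    · intro k x hk hx hle
      rw [withDensity_apply _ (D.measurableSet_cell k x)]
      refine (le_of_eq ?_).trans (hmax k x)
      refine setLIntegral_congr_fun (D.measurableSet_cell k x) fun y hy => ?_
      refine le_antisymm (iSup₂_le fun j hj => ?_)
        (iSup₂_le fun j hj => le_iSup₂_of_le j (hj.trans hk) le_rfl)
      rcases le_or_gt j k with hjk | hjk
      · exact le_iSup₂_of_le j hjk le_rfl
      · rw [cell_congr (idx_congr hjk.le hy)]
        refine (hle j hjk hj).trans (le_iSup₂_of_le k le_rfl ?_)
        rw [cell_congr hy]
  -- The measure u dx, with b = 1: the last term is now bounded through `hX`.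
  have hY : ∀ m : ℕ, ∫⁻ x in I, min (G x) m ^ δ * u x ≤ 2 * (a ^ δ * U) := by
    intro m
    have h1 := htrunc (volume.withDensity u) 1 m
      (by rw [withDensity_apply _ hIm, one_mul]) (by
        intro k x _ _ _
        rw [withDensity_apply _ (D.measurableSet_cell k x), one_mul])
    rw [restrict_withDensity hIm, lintegral_withDensity_eq_lintegral_mul₀ hu.restrict
        ((hGm.min measurable_const).pow_const δ).aemeasurable] at h1
    simp only [Pi.mul_apply, mul_comm (u _), one_mul] at h1
    have h2 : ∫⁻ x in I, min (G x) m ^ (1 + δ) ≤ ∫⁻ x in I, min (G x) m ^ δ * G x := by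
      refine lintegral_mono fun x => ?_
      rw [add_comm, ENNReal.rpow_add_of_nonneg _ _ hδ.le zero_le_one, ENNReal.rpow_one]
      gcongr
      exact min_le_left _ _
    calc _ ≤ a ^ δ * U + ENNReal.ofReal δ * c * (2 * (a ^ δ * (A * U))) :=
          h1.trans (by gcongr; exact h2.trans (hX m))
      _ = a ^ δ * U + (2 * (ENNReal.ofReal δ * (A * c))) * (a ^ δ * U) := by ring
      _ ≤ a ^ δ * U + (2 * 2⁻¹) * (a ^ δ * U) := by gcongr
      _ = _ := by
          rw [ENNReal.mul_inv_cancel two_ne_zero (by simp)]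
          ring
  have hlim : ∫⁻ x in I, G x ^ δ * u x ≤ 2 * (a ^ δ * U) := by
    have e : ∀ x, G x ^ δ * u x = ⨆ m : ℕ, min (G x) m ^ δ * u x := by
      intro x
      rw [← ENNReal.iSup_mul]
      congr 1
      have : G x = ⨆ m : ℕ, min (G x) m := by
        rw [← inf_iSup_eq (G x), ENNReal.iSup_natCast, inf_top_eq]
      conv_lhs => rw [this]
      exact (ENNReal.orderIsoRpow δ hδ).map_iSup _
    simp_rw [e]
    rw [lintegral_iSup']
    · exact iSup_le hY
    · exact fun m => ((hGm.min measurable_const).pow_const δ).aemeasurable.mul hu.restrict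
    · refine Filter.Eventually.of_forall fun x m m' hmm => ?_
      simp only
      gcongr
  calc ∫⁻ y in I, u y ^ (1 + δ) ≤ ∫⁻ x in I, G x ^ δ * u x := by
        refine lintegral_mono_ae (ae_restrict_of_ae ?_)
        filter_upwards [hdiff K] with y hy
        rw [add_comm, ENNReal.rpow_add_of_nonneg _ _ hδ.le zero_le_one, ENNReal.rpow_one]
        gcongr
    _ ≤ _ := by rw [mul_assoc]; exact hlim

end NestedGrid

/-! ### Elementary facts on cubes. -/

section Cubes

variable {n : ℕ}

lemma cube_eq_pi (a : Fin n → ℝ) (l : ℝ) :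
    cube a l = Set.univ.pi fun i => Set.Icc (a i) (a i + l) := by
  ext x
  simp only [cube, Set.mem_ofPred_eq, Set.mem_univ_pi, Set.mem_Icc]

lemma measurableSet_cube (a : Fin n → ℝ) (l : ℝ) : MeasurableSet (cube a l) := by
  rw [cube_eq_pi]
  exact MeasurableSet.univ_pi fun i => measurableSet_Icc

lemma volume_cube (a : Fin n → ℝ) (l : ℝ) : volume (cube a l) = ENNReal.ofReal l ^ n := by
  rw [cube_eq_pi, volume_pi_pi]
  simp

lemma cube_eq_closedBall (a : Fin n → ℝ) {l : ℝ} (hl : 0 ≤ l) :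
    cube a l = Metric.closedBall (fun i => a i + l / 2) (l / 2) := by
  ext x
  rw [Metric.mem_closedBall, dist_pi_le_iff (by linarith)]
  simp only [cube, Set.mem_ofPred_eq, Real.dist_eq, abs_le]
  refine forall_congr' fun i => ?_
  constructor <;> rintro ⟨h1, h2⟩ <;> constructor <;> linarith

end Cubes

/-- The `b`-adic grid of half-open cubes of side lengths `L * b ^ k`, translated by
`j / (b - 1)` in units of the side length. -/
noncomputable def boxGrid (n b : ℕ) (hb : 2 ≤ b) (L : ℝ) (j : Fin n → ℕ) : NestedGrid n where
  idx k x i := ⌊x i / (L * (b : ℝ) ^ k) - j i / ((b : ℝ) - 1)⌋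
  measurable_idx k := by
    refine measurable_pi_lambda _ fun i => ?_
    exact Int.measurable_floor.comp (by fun_prop)
  nested k x y h := by
    have hb0 : (b : ℝ) ≠ 0 := by positivity
    have hb1 : (b : ℝ) - 1 ≠ 0 := by
      have : (2 : ℝ) ≤ b := by exact_mod_cast hb
      linarith
    -- Since b/(b-1) = 1 + 1/(b-1), rescaling by b changes the shift j/(b-1) by the integer j; the
    -- index at level k thus determines the one at level k + 1.
    have key : ∀ z : Fin n → ℝ, ∀ i,
        ⌊z i / (L * (b : ℝ) ^ (k + 1)) - j i / ((b : ℝ) - 1)⌋ =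
          (⌊z i / (L * (b : ℝ) ^ k) - j i / ((b : ℝ) - 1)⌋ - (j i : ℤ)) / (b : ℤ) := by
      intro z i
      have e : z i / (L * (b : ℝ) ^ (k + 1)) - j i / ((b : ℝ) - 1) =
          (z i / (L * (b : ℝ) ^ k) - j i / ((b : ℝ) - 1) - ((j i : ℤ) : ℝ)) / (b : ℝ) := by
        rw [zpow_add_one₀ hb0]
        push_cast
        rw [← mul_assoc, ← div_div, sub_sub, sub_div]
        congr 1
        field_simp
        ring
      rw [e, Int.floor_div_natCast, Int.floor_sub_intCast]
    funext i
    have hi := congrFun h i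
    rw [key, key, hi]

/-! ### Cells of translated b-adic grids. -/

section BoxGrid

variable {n b : ℕ} {hb : 2 ≤ b} {L : ℝ} {j : Fin n → ℕ}

/-- The lower corner of the cell of `boxGrid n b hb L j` that contains `x`. -/
noncomputable def boxCorner (b : ℕ) (L : ℝ) (j : Fin n → ℕ) (k : ℤ) (x : Fin n → ℝ) :
    Fin n → ℝ := fun i =>
  L * (b : ℝ) ^ k *
    (⌊x i / (L * (b : ℝ) ^ k) - j i / ((b : ℝ) - 1)⌋ + j i / ((b : ℝ) - 1))

lemma boxGrid_cell (hL : 0 < L) (k : ℤ) (x : Fin n → ℝ) :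
    (boxGrid n b hb L j).cell k x = Set.univ.pi fun i =>
      Set.Ico (boxCorner b L j k x i) (boxCorner b L j k x i + L * (b : ℝ) ^ k) := by
  have hb0 : (0 : ℝ) < b := by positivity
  have hs : 0 < L * (b : ℝ) ^ k := by positivity
  ext y
  simp only [NestedGrid.cell, Set.mem_ofPred_eq, Set.mem_univ_pi, Set.mem_Ico, funext_iff,
    boxGrid, boxCorner]
  refine forall_congr' fun i => ?_
  rw [Int.floor_eq_iff, ← mul_add_one, ← le_div_iff₀' hs, ← div_lt_iff₀' hs]
  constructor <;> rintro ⟨h1, h2⟩ <;> constructor <;> linarith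

lemma volume_boxGrid_cell (hL : 0 < L) (k : ℤ) (x : Fin n → ℝ) :
    volume ((boxGrid n b hb L j).cell k x) = ENNReal.ofReal (L * (b : ℝ) ^ k) ^ n := by
  rw [boxGrid_cell hL, volume_pi_pi]
  simp

lemma boxGrid_side_pos (hb : 2 ≤ b) (hL : 0 < L) (k : ℤ) : 0 < L * (b : ℝ) ^ k := by
  have hb0 : (0 : ℝ) < b := by positivity
  positivity

lemma volume_boxGrid_cell_ne_zero (hL : 0 < L) (k : ℤ) (x : Fin n → ℝ) :
    volume ((boxGrid n b hb L j).cell k x) ≠ 0 := by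
  rw [volume_boxGrid_cell hL]
  exact pow_ne_zero _ (by simpa using boxGrid_side_pos hb hL k)

lemma volume_boxGrid_cell_ne_top (hL : 0 < L) (k : ℤ) (x : Fin n → ℝ) :
    volume ((boxGrid n b hb L j).cell k x) ≠ ∞ := by
  rw [volume_boxGrid_cell hL]
  exact ENNReal.pow_ne_top ENNReal.ofReal_ne_top

lemma volume_boxGrid_cell_succ (hL : 0 < L) (k : ℤ) (x : Fin n → ℝ) :
    volume ((boxGrid n b hb L j).cell (k + 1) x) =
      (b : ℝ≥0∞) ^ n * volume ((boxGrid n b hb L j).cell k x) := by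
  have hb0 : (b : ℝ) ≠ 0 := by positivity
  rw [volume_boxGrid_cell hL, volume_boxGrid_cell hL, ← mul_pow, zpow_add_one₀ hb0, ← mul_assoc,
    mul_comm, ENNReal.ofReal_mul (by positivity), ENNReal.ofReal_natCast]

lemma boxGrid_cell_subset_cube (hL : 0 < L) (k : ℤ) (x : Fin n → ℝ) :
    (boxGrid n b hb L j).cell k x ⊆ cube (boxCorner b L j k x) (L * (b : ℝ) ^ k) := by
  rw [boxGrid_cell hL, cube_eq_pi]
  exact Set.pi_mono fun i _ => Set.Ico_subset_Icc_self

lemma boxGrid_cell_ae_eq_cube (hL : 0 < L) (k : ℤ) (x : Fin n → ℝ) :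
    (boxGrid n b hb L j).cell k x =ᵐ[volume] cube (boxCorner b L j k x) (L * (b : ℝ) ^ k) := by
  refine ae_eq_of_subset_of_measure_ge (boxGrid_cell_subset_cube hL k x) ?_
    (NestedGrid.measurableSet_cell _ k x).nullMeasurableSet ?_
  · rw [volume_cube, volume_boxGrid_cell hL]
  · rw [volume_cube]
    exact ENNReal.pow_ne_top ENNReal.ofReal_ne_top

lemma avg_boxGrid_cell (hL : 0 < L) (k : ℤ) (x : Fin n → ℝ) (u : (Fin n → ℝ) → ℝ≥0∞) :
    avg ((boxGrid n b hb L j).cell k x) u =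
      avg (cube (boxCorner b L j k x) (L * (b : ℝ) ^ k)) u := by
  rw [avg, avg, measure_congr (boxGrid_cell_ae_eq_cube hL k x),
    setLIntegral_congr (boxGrid_cell_ae_eq_cube hL k x)]

/-- Cells of level at most k through y stay inside the cell of x, so cutting u off changes none of
their averages. -/
lemma localMax_boxGrid_le_maximal (hL : 0 < L) {u : (Fin n → ℝ) → ℝ≥0∞} {k : ℤ}
    {x y : Fin n → ℝ} (hy : y ∈ (boxGrid n b hb L j).cell k x) :
    (boxGrid n b hb L j).localMax u k y ≤
      maximal ((cube (boxCorner b L j k x) (L * (b : ℝ) ^ k)).indicator u) y := by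
  refine iSup₂_le fun m hm => ?_
  have hsub : (boxGrid n b hb L j).cell m y ⊆
      cube (boxCorner b L j k x) (L * (b : ℝ) ^ k) := by
    refine (NestedGrid.cell_subset_cell hm y).trans ?_
    rw [NestedGrid.cell_congr hy]
    exact boxGrid_cell_subset_cube hL k x
  have h1 : avg ((boxGrid n b hb L j).cell m y) u = avg ((boxGrid n b hb L j).cell m y)
      (fun z => ‖(cube (boxCorner b L j k x) (L * (b : ℝ) ^ k)).indicator u z‖ₑ) := by
    rw [avg, avg]
    congr 1
    refine setLIntegral_congr_fun (NestedGrid.measurableSet_cell _ m y) fun z hz => ?_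
    simp [Set.indicator_of_mem (hsub hz)]
  rw [h1, avg_boxGrid_cell hL]
  exact le_iSup_of_le _ (le_iSup_of_le _ (le_iSup_of_le (boxGrid_side_pos hb hL m)
    (le_iSup_of_le (boxGrid_cell_subset_cube (hb := hb) hL m y
      (NestedGrid.mem_cell_self _ m y)) le_rfl)))

lemma lintegral_localMax_boxGrid_le (hL : 0 < L) {u : (Fin n → ℝ) → ℝ≥0∞} {k : ℤ}
    {x : Fin n → ℝ} (h0 : ∫⁻ y in (boxGrid n b hb L j).cell k x, u y ≠ 0)
    (htop : ∫⁻ y in (boxGrid n b hb L j).cell k x, u y ≠ ∞) :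
    ∫⁻ y in (boxGrid n b hb L j).cell k x, (boxGrid n b hb L j).localMax u k y ≤
      aInftyConst u * ∫⁻ y in (boxGrid n b hb L j).cell k x, u y := by
  have hae := boxGrid_cell_ae_eq_cube (hb := hb) (j := j) hL k x
  set Q := cube (boxCorner b L j k x) (L * (b : ℝ) ^ k) with hQ
  have hA : (∫⁻ y in Q, u y)⁻¹ * ∫⁻ y in Q, maximal (Q.indicator u) y ≤ aInftyConst u :=
    le_iSup_of_le _ (le_iSup_of_le _ (le_iSup_of_le (boxGrid_side_pos hb hL k) le_rfl))
  rw [← setLIntegral_congr hae, ← setLIntegral_congr hae, mul_comm, ← div_eq_mul_inv,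
    ENNReal.div_le_iff h0 htop] at hA
  refine le_trans (setLIntegral_mono' (NestedGrid.measurableSet_cell _ k x) fun y hy => ?_) hA
  exact localMax_boxGrid_le_maximal hL hy

/-- Lebesgue differentiation along the cells of a grid. -/
lemma ae_le_localMax_boxGrid (hL : 0 < L) {u : (Fin n → ℝ) → ℝ≥0∞} (hu : AEMeasurable u)
    (hfin : ∀ k x, ∫⁻ y in (boxGrid n b hb L j).cell k x, u y ≠ ∞) (k : ℤ) :
    ∀ᵐ y, u y ≤ (boxGrid n b hb L j).localMax u k y := by
  set D := boxGrid n b hb L j with hD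
  have hb1 : (1 : ℝ) < b := by
    have : (2 : ℝ) ≤ b := by exact_mod_cast hb
    linarith
  have hcell : ∀ x : Fin n → ℝ, ∀ᵐ y, y ∈ D.cell k x → u y ≤ D.localMax u k y := by
    intro x
    set f : (Fin n → ℝ) → ℝ≥0∞ := (D.cell k x).indicator u with hf
    have hfm : AEMeasurable f := hu.indicator (D.measurableSet_cell k x)
    have hfi : ∫⁻ y, f y ≠ ∞ := by
      rw [hf, lintegral_indicator (D.measurableSet_cell k x)]
      exact hfin k x
    filter_upwards [VitaliFamily.ae_tendsto_lintegral_div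
      (IsUnifLocDoublingMeasure.vitaliFamily (volume : Measure (Fin n → ℝ)) 1) hfm hfi]
      with y hy hyx
    have hball : ∀ m : ℕ, cube (boxCorner b L j (k - m) y) (L * (b : ℝ) ^ (k - m)) =
        Metric.closedBall (fun i => boxCorner b L j (k - m) y i + L * (b : ℝ) ^ (k - m) / 2)
          (L * (b : ℝ) ^ (k - m) / 2) := fun m =>
      cube_eq_closedBall _ (boxGrid_side_pos hb hL _).le
    -- Cells agree a.e. with sup-norm balls; K = 1 admits balls that contain y without being centred
    -- there.
    have htend := IsUnifLocDoublingMeasure.tendsto_closedBall_filterAt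
      (μ := (volume : Measure (Fin n → ℝ))) (K := 1) (x := y) (l := Filter.atTop)
      (fun m : ℕ => fun i => boxCorner b L j (k - m) y i + L * (b : ℝ) ^ (k - m) / 2)
      (fun m : ℕ => L * (b : ℝ) ^ (k - m) / 2) ?_ ?_
    · have hlim := hy.comp htend
      simp only [Function.comp_def, ← hball] at hlim
      rw [show f y = u y from Set.indicator_of_mem hyx u] at hlim
      refine le_of_tendsto' hlim fun m => ?_
      have hsub : D.cell (k - m) y ⊆ D.cell k y :=
        NestedGrid.cell_subset_cell (by lia) y
      refine le_trans (le_of_eq ?_) (le_iSup₂_of_le (k - m : ℤ) (by lia) le_rfl)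
      rw [avg_boxGrid_cell hL, avg, ← ENNReal.div_eq_inv_mul,
        ← setLIntegral_congr (boxGrid_cell_ae_eq_cube (hb := hb) hL (k - m) y),
        ← setLIntegral_congr (boxGrid_cell_ae_eq_cube (hb := hb) hL (k - m) y)]
      congr 1
      refine setLIntegral_congr_fun (D.measurableSet_cell _ y) fun z hz => ?_
      refine Set.indicator_of_mem ?_ u
      rw [← NestedGrid.cell_congr hyx]
      exact hsub hz
    · rw [tendsto_nhdsWithin_iff]
      refine ⟨?_, Filter.Eventually.of_forall fun m => ?_⟩
      · have h1 : Filter.Tendsto (fun m : ℕ => L * (b : ℝ) ^ k / 2 * ((b : ℝ)⁻¹) ^ m) Filter.atTop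
            (nhds (L * (b : ℝ) ^ k / 2 * 0)) :=
          (tendsto_pow_atTop_nhds_zero_of_lt_one (by positivity)
            (inv_lt_one_of_one_lt₀ hb1)).const_mul _
        rw [mul_zero] at h1
        refine h1.congr fun m => ?_
        rw [zpow_sub₀ (by positivity), zpow_natCast, inv_pow]
        ring
      · have := boxGrid_side_pos hb hL (k - m)
        simp only [Set.mem_Ioi]
        linarith
    · refine Filter.Eventually.of_forall fun m => ?_
      rw [one_mul, ← hball]
      exact boxGrid_cell_subset_cube hL _ _ (NestedGrid.mem_cell_self (boxGrid n b hb L j) _ y)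
  have hcount : ∀ᵐ y, ∀ i : Fin n → ℤ, D.idx k y = i → u y ≤ D.localMax u k y := by
    rw [ae_all_iff]
    intro i
    by_cases h : ∃ x, D.idx k x = i
    · obtain ⟨x, rfl⟩ := h
      exact hcell x
    · exact Filter.Eventually.of_forall fun y hy => absurd ⟨y, hy⟩ h
  filter_upwards [hcount] with y hy using hy _ rfl

end BoxGrid

/-! ### Covering all cubes by finitely many grids. -/

section Covering

/-- The ratio of the consecutive side lengths of the grids in the covering family. -/
noncomputable def gridRatio (n : ℕ) : ℝ := ((n + 3 : ℕ) : ℝ) ^ ((n * (n + 3) : ℕ) : ℝ)⁻¹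

variable {n : ℕ}

lemma gridRatio_pow (hn : 0 < n) : gridRatio n ^ (n * (n + 3)) = ((n + 3 : ℕ) : ℝ) :=
  Real.rpow_inv_natCast_pow (by positivity) (by positivity)

lemma one_lt_gridRatio (hn : 0 < n) : 1 < gridRatio n := by
  refine Real.one_lt_rpow ?_ (by positivity)
  push_cast
  have : (0 : ℝ) ≤ n := by positivity
  linarith

/-- The power n + 3 of the left side is n + 3 ≤ 2^{n+3}. Passing to the next scale thus at most
doubles volumes, in every dimension. -/
lemma gridRatio_pow_dim_le_two (hn : 0 < n) : gridRatio n ^ n ≤ 2 := by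
  have h0 : 0 ≤ gridRatio n := zero_le_one.trans (one_lt_gridRatio hn).le
  refine le_of_pow_le_pow_left₀ (n := n + 3) (by lia) zero_le_two ?_
  rw [← pow_mul, gridRatio_pow hn]
  exact_mod_cast Nat.lt_two_pow_self.le

/-- (1 + 1/(n+1))^n ≤ e is the volume cost of the slack that lets n + 2 translates per axis suffice.
-/
lemma one_add_inv_pow_le_three (n : ℕ) : ((n + 2 : ℝ) / (n + 1)) ^ n ≤ 3 := by
  have h1 : (n + 2 : ℝ) / (n + 1) ≤ Real.exp (1 / (n + 1)) := by
    have := Real.add_one_le_exp (1 / (n + 1 : ℝ))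
    refine le_trans (le_of_eq ?_) this
    field_simp
    ring
  calc ((n + 2 : ℝ) / (n + 1)) ^ n ≤ Real.exp (1 / (n + 1)) ^ n := by gcongr
    _ = Real.exp (n * (1 / (n + 1))) := (Real.exp_nat_mul _ n).symm
    _ ≤ Real.exp 1 := by
        refine Real.exp_le_exp.2 ?_
        rw [mul_one_div, div_le_one (by positivity)]
        linarith
    _ ≤ 3 := Real.exp_one_lt_three.le

/-- The finite family of grids that covers all cubes up to a fixed dilation of the volume. -/
noncomputable def coveringGrid (n : ℕ) (ι : Fin (n * (n + 3)) × (Fin n → Fin (n + 2))) :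
    NestedGrid n :=
  boxGrid n (n + 3) (by lia) (gridRatio n ^ (ι.1 : ℕ)) fun i => (ι.2 i : ℕ)

/-- Every cube is contained in a cell of comparable volume of one of the grids; the factor does
not depend on the dimension. -/
lemma exists_coveringGrid_cell (hn : 0 < n) (a : Fin n → ℝ) {l : ℝ} (hl : 0 < l) :
    ∃ ι k, ∀ x ∈ cube a l, cube a l ⊆ (coveringGrid n ι).cell k x ∧
      volume ((coveringGrid n ι).cell k x) ≤ 6 * volume (cube a l) := by
  have hρ1 := one_lt_gridRatio hn
  have hρ0 : 0 < gridRatio n := zero_lt_one.trans hρ1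
  set β : ℝ := (n + 2) / (n + 1) with hβ
  have hβ0 : 0 < β := by positivity
  -- The next scale s = ρ^{m+1}, with ρ = `gridRatio n`, exceeds lβ. Hence l < s(n+1)/(n+2), and a
  -- cube starting within s/(n+2) of the lower faces of a cell still fits in it.
  obtain ⟨m, hm1, hm2⟩ := exists_mem_Ico_zpow (x := l * β) (by positivity) hρ1
  set T : ℤ := ((n * (n + 3) : ℕ) : ℤ) with hT
  have hT0 : 0 < T := by rw [hT]; exact_mod_cast (by positivity)
  have hr0 : 0 ≤ (m + 1) % T := Int.emod_nonneg _ hT0.ne'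
  have hrT : (m + 1) % T < T := Int.emod_lt_of_pos _ hT0
  set i₀ : ℕ := ((m + 1) % T).toNat with hi₀
  have hi₀T : i₀ < n * (n + 3) := by
    have : (i₀ : ℤ) < T := by rw [hi₀, Int.toNat_of_nonneg hr0]; exact hrT
    rw [hT] at this
    exact_mod_cast this
  set k : ℤ := (m + 1) / T with hk
  set s : ℝ := gridRatio n ^ i₀ * ((n + 3 : ℕ) : ℝ) ^ k with hs
  have hsm : gridRatio n ^ (m + 1) = s := by
    have e : m + 1 = (i₀ : ℤ) + T * k := by
      rw [hi₀, Int.toNat_of_nonneg hr0, hk, Int.emod_add_mul_ediv]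
    conv_lhs => rw [e]
    rw [zpow_add₀ hρ0.ne', zpow_natCast, zpow_mul, hT, zpow_natCast, gridRatio_pow hn]
  have hs0 : 0 < s := hsm ▸ zpow_pos hρ0 _
  have hls : l * β < s := hsm ▸ hm2
  have hsl : s ≤ gridRatio n * (l * β) := by
    rw [← hsm, zpow_add_one₀ hρ0.ne', mul_comm]
    gcongr
  -- The lower corner is rounded down to multiples of s/(n+2). Dividing N by n + 2, the remainder
  -- picks the translate and the quotient is the cell index.
  set N : Fin n → ℤ := fun i => ⌊a i * (n + 2) / s⌋ with hN
  have hn2 : (0 : ℤ) < (n + 2 : ℕ) := by positivity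
  have hmod : ∀ i, (N i % ((n + 2 : ℕ) : ℤ)).toNat < n + 2 := by
    intro i
    have h1 := Int.emod_nonneg (N i) hn2.ne'
    have h2 := Int.emod_lt_of_pos (N i) hn2
    lia
  refine ⟨⟨⟨i₀, hi₀T⟩, fun i => ⟨(N i % ((n + 2 : ℕ) : ℤ)).toNat, hmod i⟩⟩, k, ?_⟩
  have hidx : ∀ y ∈ cube a l, (coveringGrid n ⟨⟨i₀, hi₀T⟩,
      fun i => ⟨(N i % ((n + 2 : ℕ) : ℤ)).toNat, hmod i⟩⟩).idx k y =
        fun i => N i / ((n + 2 : ℕ) : ℤ) := by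
    intro y hy
    funext i
    simp only [coveringGrid, boxGrid]
    rw [← hs]
    have hj : (((N i % ((n + 2 : ℕ) : ℤ)).toNat : ℕ) : ℝ) =
        (N i : ℝ) - (n + 2) * ((N i / ((n + 2 : ℕ) : ℤ) : ℤ) : ℝ) := by
      have h1 := Int.emod_nonneg (N i) hn2.ne'
      have h2 : (((N i % ((n + 2 : ℕ) : ℤ)).toNat : ℕ) : ℤ) =
          N i - (n + 2 : ℕ) * (N i / ((n + 2 : ℕ) : ℤ)) := by
        rw [Int.toNat_of_nonneg h1, Int.emod_def]
      have h3 : ((((N i % ((n + 2 : ℕ) : ℤ)).toNat : ℕ) : ℤ) : ℝ) =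
          ((N i - (n + 2 : ℕ) * (N i / ((n + 2 : ℕ) : ℤ)) : ℤ) : ℝ) := by rw [h2]
      push_cast at h3 ⊢
      exact h3
    set z : ℤ := N i / ((n + 2 : ℕ) : ℤ) with hz
    rw [hj, Int.floor_eq_iff]
    have hn0 : (0 : ℝ) < n + 2 := by positivity
    have hfl1 : (N i : ℝ) ≤ a i * (n + 2) / s := Int.floor_le _
    have hfl2 : a i * (n + 2) / s < N i + 1 := Int.lt_floor_add_one _
    obtain ⟨hy1, hy2⟩ := hy i
    have e : (((n + 3 : ℕ) : ℝ) - 1) = n + 2 := by push_cast; ring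
    have e2 : ((N i : ℝ) - (n + 2) * z) / (n + 2) = N i / (n + 2) - z := by field_simp
    rw [e, e2]
    have h1 : (N i : ℝ) / (n + 2) ≤ y i / s := by
      rw [div_le_div_iff₀ hn0 hs0]
      rw [le_div_iff₀ hs0] at hfl1
      nlinarith
    have h2 : y i / s < N i / (n + 2) + 1 := by
      rw [div_lt_iff₀ hs0] at hfl2 ⊢
      have hl2 : l * (n + 2) < s * (n + 1) := by
        rw [hβ, mul_div_assoc', div_lt_iff₀ (by positivity)] at hls
        exact hls
      have h3 : (N i / (n + 2 : ℝ) + 1) * s = ((N i + 1) * s + s * (n + 1)) / (n + 2) := by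
        field_simp
        ring
      rw [h3, lt_div_iff₀ hn0]
      nlinarith
    constructor <;> linarith
  intro x hx
  refine ⟨fun y hy => (hidx y hy).trans (hidx x hx).symm, ?_⟩
  rw [coveringGrid, volume_boxGrid_cell (by positivity), volume_cube,
    ← ENNReal.ofReal_pow (by positivity), ← ENNReal.ofReal_pow hl.le, ← ENNReal.ofReal_ofNat,
    ← ENNReal.ofReal_mul (by norm_num)]
  refine ENNReal.ofReal_le_ofReal ?_
  calc s ^ n ≤ (gridRatio n * (l * β)) ^ n := by gcongr
    _ = gridRatio n ^ n * β ^ n * l ^ n := by ring_nf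
    _ ≤ 2 * 3 * l ^ n := by
        gcongr
        · exact gridRatio_pow_dim_le_two hn
        · exact one_add_inv_pow_le_three n
    _ = 6 * l ^ n := by ring

lemma exists_avg_cell_gt (hn : 0 < n) {g : (Fin n → ℝ) → ℝ≥0∞} {t : ℝ≥0∞} {x : Fin n → ℝ}
    (h : t < maximal g x) : ∃ ι k, t / 6 < avg ((coveringGrid n ι).cell k x) g := by
  simp only [maximal, lt_iSup_iff, enorm_eq_self] at h
  obtain ⟨a, l, hl, hx, h⟩ := h
  obtain ⟨ι, k, hk⟩ := exists_coveringGrid_cell hn a hl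
  obtain ⟨hsub, hvol⟩ := hk x hx
  refine ⟨ι, k, ?_⟩
  rw [ENNReal.div_lt_iff (by simp) (by simp)]
  refine h.trans_le ?_
  rw [avg, avg]
  calc (volume (cube a l))⁻¹ * ∫⁻ y in cube a l, g y
      ≤ (volume ((coveringGrid n ι).cell k x) / 6)⁻¹ *
          ∫⁻ y in (coveringGrid n ι).cell k x, g y := by
        gcongr
        exact ENNReal.div_le_of_le_mul' hvol
    _ = _ := by
        rw [ENNReal.inv_div (by simp) (by simp), div_eq_mul_inv]
        ring

end Covering

/-! ### The weak type estimate on one cell. -/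

section CellEstimate

lemma dualWeight_exponent {p : ℝ} (hp : 1 < p) : 1 - p.conjExponent = -(1 / (p - 1)) := by
  have : p - 1 ≠ 0 := by linarith
  rw [Real.conjExponent]
  field_simp
  ring

/-- Hölder's inequality together with a reverse Hölder inequality for the dual weight. -/
lemma measure_cell_le {n : ℕ} {p δ r : ℝ} (hp : 1 < p) (hδ : 0 < δ)
    (hr : r = 1 + (p - 1) / (1 + δ)) {v w g : (Fin n → ℝ) → ℝ≥0∞} (hw : AEMeasurable w)
    (hg : AEMeasurable g) (hw0 : ∀ᵐ x, w x ≠ 0) (hwtop : ∀ᵐ x, w x ≠ ∞)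
    {J : Set (Fin n → ℝ)} (hJm : MeasurableSet J) (hJ0 : volume J ≠ 0) (hJ : volume J ≠ ∞)
    {A : ℝ≥0∞} (hA : avg J v * avg J (dualWeight p w) ^ (p - 1) ≤ A)
    (hRH : ∫⁻ y in J, dualWeight p w y ^ (1 + δ) ≤
      2 * avg J (dualWeight p w) ^ δ * ∫⁻ y in J, dualWeight p w y)
    {t : ℝ≥0∞} (ht : t ≤ avg J g) :
    t ^ r * (volume.withDensity v) J ≤
      2 ^ (p - 1) * A * ∫⁻ y in J, g y ^ r ∂(volume.withDensity w) := by
  set σ := dualWeight p w with hσ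
  have hp1 : 0 < p - 1 := by linarith
  have hr1 : 1 < r := by
    rw [hr]
    have : 0 < (p - 1) / (1 + δ) := by positivity
    linarith
  have hr0 : 0 < r := by linarith
  have hrp : r - 1 ≤ p - 1 := by
    rw [hr, add_sub_cancel_left]
    exact div_le_self hp1.le (by linarith)
  have hr1δ : (1 + δ) * (r - 1) = p - 1 := by
    rw [hr]
    field_simp
    ring
  have hconj : r.HolderConjugate r.conjExponent := Real.HolderConjugate.conjExponent hr1
  set s := avg J σ with hs
  have havg : ∀ u : (Fin n → ℝ) → ℝ≥0∞, ∫⁻ y in J, u y = avg J u * volume J := by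
    intro u
    rw [avg, mul_comm, ← mul_assoc, ENNReal.mul_inv_cancel hJ0 hJ, one_mul]
  have hR : ∫⁻ y in J, g y ^ r ∂(volume.withDensity w) = ∫⁻ y in J, g y ^ r * w y := by
    rw [restrict_withDensity hJm, lintegral_withDensity_eq_lintegral_mul₀ hw.restrict
      (hg.restrict.pow_const r)]
    refine lintegral_congr fun y => ?_
    rw [Pi.mul_apply, mul_comm]
  have hHolder : (∫⁻ y in J, g y) ^ r ≤
      (∫⁻ y in J, g y ^ r * w y) * (∫⁻ y in J, σ y ^ (1 + δ)) ^ (r - 1) := by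
    have h1 := ENNReal.lintegral_mul_le_Lp_mul_Lq (volume.restrict J) hconj
      (f := fun y => g y * w y ^ (1 / r)) (g := fun y => w y ^ (-(1 / r)))
      (hg.restrict.mul (hw.restrict.pow_const _)) (hw.restrict.pow_const _)
    have e1 : ∫⁻ y in J, g y = ∫⁻ y in J,
        ((fun y => g y * w y ^ (1 / r)) * (fun y => w y ^ (-(1 / r)))) y := by
      refine lintegral_congr_ae (ae_restrict_of_ae ?_)
      filter_upwards [hw0, hwtop] with y h0 htop
      rw [Pi.mul_apply, mul_assoc, ← ENNReal.rpow_add _ _ h0 htop]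
      simp
    have e2 : ∫⁻ y in J, (g y * w y ^ (1 / r)) ^ r = ∫⁻ y in J, g y ^ r * w y := by
      refine lintegral_congr fun y => ?_
      rw [ENNReal.mul_rpow_of_nonneg _ _ hr0.le, ← ENNReal.rpow_mul, one_div_mul_cancel hr0.ne',
        ENNReal.rpow_one]
    -- r'/r = 1/(r-1) = (1+δ)/(p-1), which is why r was chosen so.
    have e3 : ∫⁻ y in J, (w y ^ (-(1 / r))) ^ r.conjExponent = ∫⁻ y in J, σ y ^ (1 + δ) := by
      refine lintegral_congr fun y => ?_
      rw [hσ, dualWeight, ← ENNReal.rpow_mul, ← ENNReal.rpow_mul, dualWeight_exponent hp]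
      congr 1
      have h2 : r - 1 ≠ 0 := by linarith
      rw [Real.conjExponent, ← hr1δ]
      field_simp
    rw [← e1, e2, e3] at h1
    refine (ENNReal.rpow_le_rpow h1 hr0.le).trans (le_of_eq ?_)
    rw [ENNReal.mul_rpow_of_nonneg _ _ hr0.le, ← ENNReal.rpow_mul, ← ENNReal.rpow_mul,
      one_div_mul_cancel hr0.ne', ENNReal.rpow_one]
    congr 2
    have h2 : r - 1 ≠ 0 := by linarith
    rw [Real.conjExponent]
    field_simp
  -- Raising the reverse Hölder bound to the power r - 1 yields s^{(1+δ)(r-1)} = s^{p-1}, the power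
  -- in the A_p constant.
  have hσδ : (∫⁻ y in J, σ y ^ (1 + δ)) ^ (r - 1) ≤
      2 ^ (p - 1) * s ^ (p - 1) * volume J ^ (r - 1) := by
    have hr10 : 0 ≤ r - 1 := by linarith
    have h1 : ∫⁻ y in J, σ y ^ (1 + δ) ≤ 2 * s ^ (1 + δ) * volume J := by
      refine hRH.trans (le_of_eq ?_)
      rw [havg σ, ← hs, add_comm 1 δ, ENNReal.rpow_add_of_nonneg _ _ hδ.le zero_le_one,
        ENNReal.rpow_one]
      ring
    refine (ENNReal.rpow_le_rpow h1 hr10).trans ?_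
    rw [ENNReal.mul_rpow_of_nonneg _ _ hr10, ENNReal.mul_rpow_of_nonneg _ _ hr10,
      ← ENNReal.rpow_mul, hr1δ]
    gcongr
    exact one_le_two
  have ht' : t * volume J ≤ ∫⁻ y in J, g y := by
    rw [havg g]
    gcongr
  have hJr0 : volume J ^ r ≠ 0 := by
    simp [ENNReal.rpow_eq_zero_iff, hJ0, hJ]
  have hJr : volume J ^ r ≠ ∞ := ENNReal.rpow_ne_top_of_nonneg hr0.le hJ
  rw [hR, withDensity_apply _ hJm, ← ENNReal.mul_le_mul_iff_left hJr0 hJr]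
  calc t ^ r * (∫⁻ y in J, v y) * volume J ^ r
      = (t * volume J) ^ r * ∫⁻ y in J, v y := by
        rw [ENNReal.mul_rpow_of_nonneg _ _ hr0.le]
        ring
    _ ≤ ((∫⁻ y in J, g y ^ r * w y) * (2 ^ (p - 1) * s ^ (p - 1) * volume J ^ (r - 1))) *
        (avg J v * volume J) := by
        rw [havg v]
        gcongr
        exact (ENNReal.rpow_le_rpow ht' hr0.le).trans (hHolder.trans (by gcongr))
    _ = 2 ^ (p - 1) * (avg J v * s ^ (p - 1)) * (∫⁻ y in J, g y ^ r * w y) *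
        (volume J ^ (r - 1) * volume J) := by ring
    _ ≤ 2 ^ (p - 1) * A * (∫⁻ y in J, g y ^ r * w y) * volume J ^ r := by
        have e : volume J ^ (r - 1) * volume J = volume J ^ r := by
          nth_rewrite 2 [← ENNReal.rpow_one (volume J)]
          rw [← ENNReal.rpow_add _ _ hJ0 hJ, sub_add_cancel]
        rw [e]
        gcongr

end CellEstimate

/-! ### Finiteness, positivity and degenerate cases for the weights. -/

section Weights

variable {n : ℕ}

lemma setLIntegral_ne_zero_of_ae_pos {u : (Fin n → ℝ) → ℝ≥0∞} (hu : AEMeasurable u)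
    (hpos : ∀ᵐ x, 0 < u x) {S : Set (Fin n → ℝ)} (hS : volume S ≠ 0) :
    ∫⁻ x in S, u x ≠ 0 := by
  rw [Ne, lintegral_eq_zero_iff' hu.restrict]
  intro h
  have h2 : ∀ᵐ x ∂(volume.restrict S), False := by
    filter_upwards [h, ae_restrict_of_ae hpos] with x h1 h2
    exact h2.ne' h1
  have h3 : volume.restrict S = 0 := by
    rwa [← ae_eq_bot, ← Filter.empty_mem_iff_bot]
  exact hS (Measure.restrict_eq_zero.1 h3)

lemma volume_cube_ne_zero (a : Fin n → ℝ) {l : ℝ} (hl : 0 < l) : volume (cube a l) ≠ 0 := by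
  rw [volume_cube]
  exact pow_ne_zero _ (by simpa using hl)

lemma volume_cube_ne_top (a : Fin n → ℝ) (l : ℝ) : volume (cube a l) ≠ ∞ := by
  rw [volume_cube]
  exact ENNReal.pow_ne_top ENNReal.ofReal_ne_top

/-- The dual average over a cube is nonzero, so an infinite average of u would make the A_s constant
infinite. -/
lemma MemAInfty.setLIntegral_cube_ne_top {u : (Fin n → ℝ) → ℝ≥0∞} (hu : MemAInfty u)
    (a : Fin n → ℝ) {l : ℝ} (hl : 0 < l) : ∫⁻ x in cube a l, u x ≠ ∞ := by
  obtain ⟨⟨hm, hfin⟩, hpos, s, hs, hA⟩ := hu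
  have hs1 : 0 < s - 1 := by linarith
  have hle : avg (cube a l) u * avg (cube a l) (dualWeight s u) ^ (s - 1) ≤ apConst s u u :=
    le_iSup_of_le a (le_iSup_of_le l (le_iSup_of_le hl le_rfl))
  have hdual : avg (cube a l) (dualWeight s u) ≠ 0 := by
    refine mul_ne_zero (ENNReal.inv_ne_zero.2 (volume_cube_ne_top a l))
      (setLIntegral_ne_zero_of_ae_pos (hm.pow_const _) ?_ (volume_cube_ne_zero a hl))
    filter_upwards [hfin, hpos] with x h1 h2
    exact ENNReal.rpow_pos h2 h1.ne
  intro htop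
  have h1 : avg (cube a l) u = ∞ := by
    rw [avg, htop, ENNReal.mul_top (ENNReal.inv_ne_zero.2 (volume_cube_ne_top a l))]
  rw [h1, ENNReal.top_mul] at hle
  · exact absurd (hle.trans_lt hA) (lt_irrefl _)
  · intro h
    rw [ENNReal.rpow_eq_zero_iff_of_pos hs1] at h
    exact hdual h

/-- On Q the maximal function is at least the average of u. The bound later allows 1 + 1/δ to be
absorbed into a multiple of [σ]_{A_∞}. -/
lemma MemAInfty.one_le_aInftyConst {u : (Fin n → ℝ) → ℝ≥0∞} (hu : MemAInfty u) :
    1 ≤ aInftyConst u := by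
  set Q := cube (0 : Fin n → ℝ) 1 with hQ
  have hQ0 : volume Q ≠ 0 := volume_cube_ne_zero _ one_pos
  have hQt : volume Q ≠ ∞ := volume_cube_ne_top _ _
  have h0 : ∫⁻ x in Q, u x ≠ 0 := setLIntegral_ne_zero_of_ae_pos hu.1.1 hu.2.1 hQ0
  have ht : ∫⁻ x in Q, u x ≠ ∞ := hu.setLIntegral_cube_ne_top 0 one_pos
  have hmean : ∀ x ∈ Q, avg Q u ≤ maximal (Q.indicator u) x := by
    intro x hx
    have e : avg Q u = avg Q (fun y => ‖Q.indicator u y‖ₑ) := by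
      rw [avg, avg]
      congr 1
      refine setLIntegral_congr_fun (measurableSet_cube 0 1) fun y hy => ?_
      simp [Set.indicator_of_mem hy]
    rw [e]
    exact le_iSup_of_le _ (le_iSup_of_le _ (le_iSup_of_le one_pos (le_iSup_of_le hx le_rfl)))
  calc (1 : ℝ≥0∞) = (∫⁻ x in Q, u x)⁻¹ * ∫⁻ _ in Q, avg Q u := by
        rw [setLIntegral_const, avg, mul_comm _ (volume Q), ← mul_assoc (volume Q),
          ENNReal.mul_inv_cancel hQ0 hQt, one_mul, ENNReal.inv_mul_cancel h0 ht]
    _ ≤ (∫⁻ x in Q, u x)⁻¹ * ∫⁻ x in Q, maximal (Q.indicator u) x := by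
        gcongr 1
        exact setLIntegral_mono' (measurableSet_cube 0 1) hmean
    _ ≤ aInftyConst u :=
        le_iSup_of_le _ (le_iSup_of_le _ (le_iSup_of_le one_pos le_rfl))

/-- Averages of σ are positive and finite, so those of v vanish. This settles the case where the
bound could read 0 · ∞ = 0. -/
lemma withDensity_eq_zero_of_apConst_eq_zero {p : ℝ} {v w : (Fin n → ℝ) → ℝ≥0∞}
    (hσ : MemAInfty (dualWeight p w)) (hA : apConst p v w = 0) :
    volume.withDensity v = 0 := by
  have hcube : ∀ m : ℕ, (volume.withDensity v) (cube (fun _ : Fin n => -((m : ℝ) + 1))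
      (2 * ((m : ℝ) + 1))) = 0 := by
    intro m
    have hl : (0 : ℝ) < 2 * ((m : ℝ) + 1) := by positivity
    set Q := cube (fun _ : Fin n => -((m : ℝ) + 1)) (2 * ((m : ℝ) + 1)) with hQ
    have hle : avg Q v * avg Q (dualWeight p w) ^ (p - 1) ≤ 0 := by
      rw [← hA]
      exact le_iSup_of_le _ (le_iSup_of_le _ (le_iSup_of_le hl le_rfl))
    have hQt : (volume Q)⁻¹ ≠ 0 := ENNReal.inv_ne_zero.2 (volume_cube_ne_top _ _)
    have hne : avg Q (dualWeight p w) ^ (p - 1) ≠ 0 := by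
      refine (ENNReal.rpow_pos (pos_iff_ne_zero.2 (mul_ne_zero hQt ?_)) ?_).ne'
      · exact setLIntegral_ne_zero_of_ae_pos hσ.1.1 hσ.2.1 (volume_cube_ne_zero _ hl)
      · exact ENNReal.mul_ne_top (ENNReal.inv_ne_top.2 (volume_cube_ne_zero _ hl))
          (hσ.setLIntegral_cube_ne_top _ hl)
    have h0 : avg Q v = 0 := (mul_eq_zero.1 (le_antisymm hle bot_le)).resolve_right hne
    rw [withDensity_apply _ (measurableSet_cube _ _)]
    exact (mul_eq_zero.1 h0).resolve_left hQt
  have huniv : (Set.univ : Set (Fin n → ℝ)) = ⋃ m : ℕ, cube (fun _ : Fin n => -((m : ℝ) + 1))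
      (2 * ((m : ℝ) + 1)) := by
    refine (Set.eq_univ_of_forall fun x => ?_).symm
    obtain ⟨m, hm⟩ := exists_nat_ge ‖x‖
    refine Set.mem_iUnion.2 ⟨m, fun i => ?_⟩
    have h1 := abs_le.1 ((norm_le_pi_norm x i).trans hm)
    constructor <;> linarith [h1.1, h1.2]
  rw [← Measure.measure_univ_eq_zero, huniv]
  exact measure_iUnion_null hcube

end Weights

/-! ### Weak type (r,r) and the distribution function of Mf. -/

section WeakType

variable {n : ℕ} {p δ r : ℝ} {v w : (Fin n → ℝ) → ℝ≥0∞}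

/-- The number of grids in the covering family. -/
def gridCount (n : ℕ) : ℕ := n * (n + 3) * (n + 2) ^ n

/-- The choice of δ makes δ [σ]_{A_∞} (n+3)^n = 1/2, the smallness needed for the reverse Hölder
inequality. The cell estimate then passes to the union of the selected cells. -/
lemma weak_type_coveringGrid (hn : 0 < n) (hp : 1 < p) (hw : IsWeight w)
    (hσ : MemAInfty (dualWeight p w)) (hσA : aInftyConst (dualWeight p w) ≠ ∞)
    (hδ : δ = (2 * (n + 3) ^ n * (aInftyConst (dualWeight p w)).toReal)⁻¹)
    (hr : r = 1 + (p - 1) / (1 + δ)) {g : (Fin n → ℝ) → ℝ≥0∞} (hg : AEMeasurable g)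
    (t : ℝ≥0∞) (ι : Fin (n * (n + 3)) × (Fin n → Fin (n + 2))) :
    t ^ r * (volume.withDensity v) {x | ∃ k, t < avg ((coveringGrid n ι).cell k x) g} ≤
      2 ^ (p - 1) * apConst p v w * ∫⁻ y, g y ^ r ∂(volume.withDensity w) := by
  set σ := dualWeight p w with hσdef
  set Aσ := aInftyConst σ with hAσ
  set L : ℝ := gridRatio n ^ (ι.1 : ℕ) with hLdef
  have hL : 0 < L := pow_pos (zero_lt_one.trans (one_lt_gridRatio hn)) _
  set D := coveringGrid n ι with hD
  have hAσ1 : 1 ≤ Aσ := hσ.one_le_aInftyConst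
  have hAσr : 1 ≤ Aσ.toReal := by
    rw [← ENNReal.toReal_one]
    exact ENNReal.toReal_mono hσA hAσ1
  have hδ0 : 0 < δ := by
    rw [hδ]
    positivity
  have hvol0 : ∀ k x, volume (D.cell k x) ≠ 0 := fun k x => volume_boxGrid_cell_ne_zero hL k x
  have hvol : ∀ k x, volume (D.cell k x) ≠ ∞ := fun k x => volume_boxGrid_cell_ne_top hL k x
  have hfin : ∀ k x, ∫⁻ y in D.cell k x, σ y ≠ ∞ := fun k x =>
    ne_top_of_le_ne_top (hσ.setLIntegral_cube_ne_top _ (boxGrid_side_pos (by lia) hL k))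
      (lintegral_mono_set (boxGrid_cell_subset_cube hL k x))
  have hwtop : ∀ᵐ x, w x ≠ ∞ := hw.2.mono fun x hx => hx.ne
  have hexp : 1 - p.conjExponent < 0 := by
    rw [dualWeight_exponent hp, neg_lt_zero]
    have : 0 < p - 1 := by linarith
    positivity
  -- Where w vanishes σ is infinite, which happens only on a null set.
  have hw0 : ∀ᵐ x, w x ≠ 0 := by
    filter_upwards [hσ.1.2] with x hx h0
    rw [hσdef, dualWeight, h0, ENNReal.zero_rpow_of_neg hexp] at hx
    exact lt_irrefl _ hx
  have hRH := D.reverse_holder (u := σ) hσ.1.1 (c := ((n + 3 : ℕ) : ℝ≥0∞) ^ n) (A := Aσ) hδ0 hσA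
    (by
      have e : Aσ * ((n + 3 : ℕ) : ℝ≥0∞) ^ n = ENNReal.ofReal (Aσ.toReal * (n + 3) ^ n) := by
        rw [ENNReal.ofReal_mul (by positivity), ENNReal.ofReal_toReal hσA,
          ENNReal.ofReal_pow (by positivity)]
        congr 2
        rw [← ENNReal.ofReal_natCast]
        push_cast
        rfl
      rw [e, ← ENNReal.ofReal_mul hδ0.le, ← ENNReal.ofReal_ofNat,
        ← ENNReal.ofReal_inv_of_pos two_pos]
      refine ENNReal.ofReal_le_ofReal (le_of_eq ?_)
      rw [hδ]
      field_simp) hvol0 hvol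
    (fun k x => (volume_boxGrid_cell_succ hL k x).le) hfin
    (fun k x => lintegral_localMax_boxGrid_le hL
      (setLIntegral_ne_zero_of_ae_pos hσ.1.1 hσ.2.1 (hvol0 k x)) (hfin k x))
    (fun k => ae_le_localMax_boxGrid hL hσ.1.1 hfin k)
  set c : ℝ≥0∞ := 2 ^ (p - 1) * apConst p v w with hc
  have key := NestedGrid.measure_le_of_cells (D := D) (μ := t ^ r • volume.withDensity v)
    (ν := c • (volume.withDensity w).withDensity fun y => g y ^ r)
    (P := fun k x => t < avg (D.cell k x) g) ?_ ?_
  · rw [Measure.smul_apply, smul_eq_mul] at key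
    refine key.trans ((measure_mono (Set.subset_univ _)).trans (le_of_eq ?_))
    rw [Measure.smul_apply, smul_eq_mul, withDensity_apply _ MeasurableSet.univ,
      Measure.restrict_univ]
  · intro k x y hxy h
    rwa [← NestedGrid.cell_congr hxy]
  · intro k x h
    rw [Measure.smul_apply, smul_eq_mul, Measure.smul_apply, smul_eq_mul,
      withDensity_apply (fun y => g y ^ r) (D.measurableSet_cell k x)]
    refine measure_cell_le hp hδ0 hr hw.1 hg hw0 hwtop (D.measurableSet_cell k x) (hvol0 k x)
      (hvol k x) ?_ (hRH k x) h.le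
    rw [hD, coveringGrid, avg_boxGrid_cell hL, avg_boxGrid_cell hL]
    exact le_iSup_of_le _ (le_iSup_of_le _ (le_iSup_of_le (boxGrid_side_pos (by lia) hL k) le_rfl))

/-- The weak type `(r, r)` inequality for an exponent `r` smaller than `p`. -/
lemma weak_type_maximal (hn : 0 < n) (hp : 1 < p) (hw : IsWeight w)
    (hσ : MemAInfty (dualWeight p w)) (hσA : aInftyConst (dualWeight p w) ≠ ∞)
    (hδ : δ = (2 * (n + 3) ^ n * (aInftyConst (dualWeight p w)).toReal)⁻¹)
    (hr : r = 1 + (p - 1) / (1 + δ)) (hr0 : 0 < r) {g : (Fin n → ℝ) → ℝ≥0∞}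
    (hg : AEMeasurable g) (t : ℝ≥0∞) :
    t ^ r * (volume.withDensity v) {x | t < maximal g x} ≤
      gridCount n * 6 ^ r * 2 ^ (p - 1) * apConst p v w *
        ∫⁻ y, g y ^ r ∂(volume.withDensity w) := by
  set c : ℝ≥0∞ := 2 ^ (p - 1) * apConst p v w * ∫⁻ y, g y ^ r ∂(volume.withDensity w) with hc
  have hsub : {x | t < maximal g x} ⊆ ⋃ ι : Fin (n * (n + 3)) × (Fin n → Fin (n + 2)),
      {x | ∃ k, t / 6 < avg ((coveringGrid n ι).cell k x) g} := by
    intro x hx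
    obtain ⟨ι, k, h⟩ := exists_avg_cell_gt hn hx
    exact Set.mem_iUnion.2 ⟨ι, k, h⟩
  have ht : t ^ r = 6 ^ r * (t / 6) ^ r := by
    rw [← ENNReal.mul_rpow_of_nonneg _ _ hr0.le, ENNReal.mul_div_cancel (by simp) (by simp)]
  calc t ^ r * (volume.withDensity v) {x | t < maximal g x}
      ≤ 6 ^ r * (t / 6) ^ r * ∑ ι : Fin (n * (n + 3)) × (Fin n → Fin (n + 2)),
        (volume.withDensity v) {x | ∃ k, t / 6 < avg ((coveringGrid n ι).cell k x) g} := by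
        rw [ht]
        gcongr
        exact (measure_mono hsub).trans (measure_iUnion_fintype_le _ _)
    _ = 6 ^ r * ∑ ι : Fin (n * (n + 3)) × (Fin n → Fin (n + 2)), (t / 6) ^ r *
        (volume.withDensity v) {x | ∃ k, t / 6 < avg ((coveringGrid n ι).cell k x) g} := by
        rw [mul_assoc, Finset.mul_sum]
    _ ≤ 6 ^ r * ∑ ι : Fin (n * (n + 3)) × (Fin n → Fin (n + 2)), c := by
        gcongr with ι
        exact weak_type_coveringGrid hn hp hw hσ hσA hδ hr hg (t / 6) ι
    _ = _ := by
        rw [Finset.sum_const, Finset.card_univ, hc, nsmul_eq_mul]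
        simp only [Fintype.card_prod, Fintype.card_fin, Fintype.card_fun, gridCount]
        ring

lemma maximal_le_maximal_indicator_add (g : (Fin n → ℝ) → ℝ≥0∞) (s : ℝ≥0∞) (x : Fin n → ℝ) :
    maximal g x ≤ maximal ({y | s < g y}.indicator g) x + s := by
  refine iSup_le fun a => iSup_le fun l => iSup_le fun hl => iSup_le fun hx => ?_
  simp only [enorm_eq_self]
  have h1 : avg (cube a l) g ≤ avg (cube a l) ({y | s < g y}.indicator g) + s := by
    rw [avg, avg]
    calc (volume (cube a l))⁻¹ * ∫⁻ y in cube a l, g y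
        ≤ (volume (cube a l))⁻¹ * ∫⁻ y in cube a l, ({y | s < g y}.indicator g y + s) := by
          gcongr with y
          by_cases hy : s < g y
          · rw [Set.indicator_of_mem (by exact hy)]
            exact le_self_add
          · exact (not_lt.1 hy).trans le_add_self
      _ = _ := by
          rw [lintegral_add_right _ measurable_const, setLIntegral_const, mul_add, mul_comm s,
            ← mul_assoc _ (volume _), ENNReal.inv_mul_cancel (volume_cube_ne_zero a hl)
              (volume_cube_ne_top a l), one_mul]
  refine h1.trans ?_
  gcongr
  refine le_iSup_of_le a (le_iSup_of_le l (le_iSup_of_le hl (le_iSup_of_le hx ?_)))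
  simp only [enorm_eq_self]
  exact le_rfl

/-- The distribution function of the maximal function is controlled by a Hardy type average of
the distribution function of the function. -/
lemma distribution_maximal_le (hn : 0 < n) (hp : 1 < p) (hw : IsWeight w)
    (hσ : MemAInfty (dualWeight p w)) (hσA : aInftyConst (dualWeight p w) ≠ ∞)
    (hδ : δ = (2 * (n + 3) ^ n * (aInftyConst (dualWeight p w)).toReal)⁻¹)
    (hr : r = 1 + (p - 1) / (1 + δ)) (hr0 : 0 < r) {g : (Fin n → ℝ) → ℝ≥0∞}
    (hg : Measurable g) {s : ℝ} (hs : 0 < s) :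
    (volume.withDensity v) {x | ENNReal.ofReal s < maximal g x} ≤
      gridCount n * 6 ^ r * 2 ^ (p - 1) * apConst p v w *
        ∫⁻ u in Set.Ioi (0 : ℝ), ENNReal.ofReal (r * u ^ (r - 1)) *
          (volume.withDensity w) {x | ENNReal.ofReal (s / 2 * max u 1) < g x} := by
  set τ := ENNReal.ofReal (s / 2) with hτ
  have hτ0 : τ ≠ 0 := by
    rw [hτ, Ne, ENNReal.ofReal_eq_zero, not_le]
    positivity
  have hττ : ENNReal.ofReal s = τ + τ := by
    rw [hτ, ← ENNReal.ofReal_add (by positivity) (by positivity), add_halves]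
  set g₁ := {y | τ < g y}.indicator g with hg₁
  have hg₁m : Measurable g₁ := hg.indicator (measurableSet_lt measurable_const hg)
  -- Here s = 2τ, and the part of g at heights up to τ raises the maximal function by at most τ.
  have hsub : {x | ENNReal.ofReal s < maximal g x} ⊆ {x | τ < maximal g₁ x} := by
    intro x hx
    by_contra hcon
    refine absurd (lt_of_lt_of_le hx (maximal_le_maximal_indicator_add g τ x)) (not_lt.2 ?_)
    rw [hττ]
    gcongr
    exact not_lt.1 hcon
  have hweak := weak_type_maximal (v := v) hn hp hw hσ hσA hδ hr hr0 hg₁m.aemeasurable τ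
  set c : ℝ≥0∞ := gridCount n * 6 ^ r * 2 ^ (p - 1) * apConst p v w with hc
  have hτr0 : τ ^ r ≠ 0 := by simp [ENNReal.rpow_eq_zero_iff, hτ0, hr0.le, hr0]
  have hτr : τ ^ r ≠ ∞ := ENNReal.rpow_ne_top_of_nonneg hr0.le ENNReal.ofReal_ne_top
  have hcake := lintegral_rpow_eq_lintegral_superlevel (volume.withDensity w)
    (g := fun x => g₁ x / τ) (hg₁m.div_const τ) hr0
  have e1 : ∫⁻ y, g₁ y ^ r ∂(volume.withDensity w) =
      τ ^ r * ∫⁻ y, (g₁ y / τ) ^ r ∂(volume.withDensity w) := by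
    rw [← lintegral_const_mul _ ((hg₁m.div_const τ).pow_const r)]
    refine lintegral_congr fun y => ?_
    rw [← ENNReal.mul_rpow_of_nonneg _ _ hr0.le, ENNReal.mul_div_cancel hτ0 ENNReal.ofReal_ne_top]
  -- For u < 1 the level uτ lies below the cutoff τ, and the condition reduces to g > τ; hence
  -- max(u,1).
  have e2 : ∀ u ∈ Set.Ioi (0 : ℝ), {x | ENNReal.ofReal u < g₁ x / τ} =
      {x | ENNReal.ofReal (s / 2 * max u 1) < g x} := by
    intro u hu
    have hu : 0 < u := hu
    ext x
    simp only [Set.mem_ofPred_eq]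
    rw [ENNReal.lt_div_iff_mul_lt (Or.inl hτ0) (Or.inl ENNReal.ofReal_ne_top), hτ,
      ← ENNReal.ofReal_mul hu.le, mul_max_of_nonneg _ _ (by positivity : 0 ≤ s / 2), mul_one,
      ENNReal.ofReal_max, max_lt_iff, mul_comm (s / 2)]
    by_cases hx : τ < g x
    · rw [hg₁, Set.indicator_of_mem (by exact hx)]
      exact ⟨fun h => ⟨h, hx⟩, fun h => h.1⟩
    · rw [hg₁, Set.indicator_of_notMem (by exact hx)]
      exact ⟨fun h => absurd h not_lt_zero, fun h => absurd h.2 hx⟩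
  rw [e1, hcake, setLIntegral_congr_fun measurableSet_Ioi (fun u hu => by rw [e2 u hu])] at hweak
  refine (measure_mono hsub).trans ?_
  rw [← ENNReal.mul_le_mul_iff_right hτr0 hτr]
  refine hweak.trans (le_of_eq ?_)
  ring

end WeakType

/-! ### Lorentz norm bounds and bookkeeping of constants. -/

section Lorentz

variable {n : ℕ} {p r : ℝ} {q : ℝ≥0∞} {v w : (Fin n → ℝ) → ℝ≥0∞} {K : ℝ≥0∞}

lemma maximal_congr_enorm {F : Type*} [ENorm F] {f : (Fin n → ℝ) → F}
    {g : (Fin n → ℝ) → ℝ≥0∞} (hfg : (fun x => ‖f x‖ₑ) =ᵐ[volume] g) : maximal f = maximal g := by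
  funext x
  have h : ∀ a l, avg (cube a l) (fun y => ‖f y‖ₑ) = avg (cube a l) fun y => ‖g y‖ₑ := by
    intro a l
    rw [avg, avg]
    congr 1
    refine lintegral_congr_ae (ae_restrict_of_ae ?_)
    filter_upwards [hfg] with y hy
    rw [enorm_eq_self]
    exact hy
  simp only [maximal, h]

lemma lorentzNorm_congr_enorm {F : Type*} [ENorm F] {f : (Fin n → ℝ) → F}
    {g : (Fin n → ℝ) → ℝ≥0∞} (hfg : (fun x => ‖f x‖ₑ) =ᵐ[volume] g) :
    lorentzNorm p q w f = lorentzNorm p q w g := by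
  have h : ∀ s : ℝ, (volume.withDensity w) {x | ENNReal.ofReal s < ‖f x‖ₑ} =
      (volume.withDensity w) {x | ENNReal.ofReal s < ‖g x‖ₑ} := by
    intro s
    refine measure_congr ((withDensity_absolutelyContinuous volume w).ae_eq ?_)
    filter_upwards [hfg] with x hx
    refine congrArg (fun z => ENNReal.ofReal s < z) ?_
    rw [enorm_eq_self]
    exact hx
  simp only [lorentzNorm, h]

lemma antitone_distribution (μ : Measure (Fin n → ℝ)) (g : (Fin n → ℝ) → ℝ≥0∞) :
    Antitone fun t : ℝ => μ {x | ENNReal.ofReal t < g x} := fun _ _ hst =>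
  measure_mono fun _ hx => lt_of_le_of_lt (ENNReal.ofReal_le_ofReal hst) hx

lemma lorentzNorm_maximal_le_of_le {g : (Fin n → ℝ) → ℝ≥0∞} (hr : 0 < r) (hrp : r < p)
    (hpq : ENNReal.ofReal p ≤ q)
    (h : ∀ s : ℝ, 0 < s → (volume.withDensity v) {x | ENNReal.ofReal s < maximal g x} ≤
      K * ∫⁻ u in Set.Ioi (0 : ℝ), ENNReal.ofReal (r * u ^ (r - 1)) *
          (volume.withDensity w) {x | ENNReal.ofReal (s / 2 * max u 1) < g x}) :
    lorentzNorm p q v (maximal g) ≤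
      2 * (K * ENNReal.ofReal (p / (p - r))) ^ (1 / p) * lorentzNorm p q w g := by
  have hp : 0 < p := hr.trans hrp
  by_cases hq : q = ∞
  · simp only [lorentzNorm, if_pos hq, enorm_eq_self]
    exact lorentz_hardy_top hr hrp h
  · have hpq' : p ≤ q.toReal := (ENNReal.ofReal_le_iff_le_toReal hq).1 hpq
    have hq0 : 0 < q.toReal := hp.trans_le hpq'
    simp only [lorentzNorm, if_neg hq, enorm_eq_self]
    have key := lorentz_hardy_of_le (antitone_distribution (volume.withDensity w) g).measurable
      hr hrp hpq' h
    refine (ENNReal.rpow_le_rpow (mul_le_mul_right key _)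
      (by positivity : 0 ≤ 1 / q.toReal)).trans (le_of_eq ?_)
    rw [mul_left_comm, ENNReal.mul_rpow_of_nonneg _ _ (by positivity : 0 ≤ 1 / q.toReal),
      ENNReal.mul_rpow_of_nonneg _ _ (by positivity : 0 ≤ 1 / q.toReal), ← ENNReal.rpow_mul,
      ← ENNReal.rpow_mul, mul_one_div_cancel hq0.ne', ENNReal.rpow_one,
      show q.toReal / p * (1 / q.toReal) = 1 / p by field_simp]

lemma lorentzNorm_maximal_le_of_ge {g : (Fin n → ℝ) → ℝ≥0∞} (hr : 0 < r) (hrp : r < p)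
    (hq0 : 0 < q) (hqp : q ≤ ENNReal.ofReal p)
    (h : ∀ s : ℝ, 0 < s → (volume.withDensity v) {x | ENNReal.ofReal s < maximal g x} ≤
      K * ∫⁻ u in Set.Ioi (0 : ℝ), ENNReal.ofReal (r * u ^ (r - 1)) *
          (volume.withDensity w) {x | ENNReal.ofReal (s / 2 * max u 1) < g x}) :
    lorentzNorm p q v (maximal g) ≤
      2 * K ^ (1 / p) * ENNReal.ofReal (2 * (p / (p - r))) ^ (1 / q.toReal) *
        lorentzNorm p q w g := by
  have hp : 0 < p := hr.trans hrp
  have hq : q ≠ ∞ := ne_top_of_le_ne_top ENNReal.ofReal_ne_top hqp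
  have hqp' : q.toReal ≤ p := ENNReal.toReal_le_of_le_ofReal hp.le hqp
  have hq0 : 0 < q.toReal := ENNReal.toReal_pos hq0.ne' hq
  simp only [lorentzNorm, if_neg hq, enorm_eq_self]
  have hanti := antitone_distribution (volume.withDensity w) g
  have key := lorentz_hardy_of_ge hanti hanti.measurable hr hrp hq0 hqp' h
  refine (ENNReal.rpow_le_rpow (mul_le_mul_right key _)
    (by positivity : 0 ≤ 1 / q.toReal)).trans (le_of_eq ?_)
  rw [mul_left_comm, ENNReal.mul_rpow_of_nonneg _ _ (by positivity : 0 ≤ 1 / q.toReal),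
    ENNReal.mul_rpow_of_nonneg _ _ (by positivity : 0 ≤ 1 / q.toReal),
    ENNReal.mul_rpow_of_nonneg _ _ (by positivity : 0 ≤ 1 / q.toReal), ← ENNReal.rpow_mul,
    ← ENNReal.rpow_mul, mul_one_div_cancel hq0.ne', ENNReal.rpow_one,
    show q.toReal / p * (1 / q.toReal) = 1 / p by field_simp]

lemma lorentzNorm_eq_zero_of_withDensity_eq_zero (hp : 0 < p) (hq : 0 < q)
    (hv : volume.withDensity v = 0) (g : (Fin n → ℝ) → ℝ≥0∞) : lorentzNorm p q v g = 0 := by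
  by_cases hqt : q = ∞
  · simp [lorentzNorm, hqt, hv, hp]
  · have hq0 : 0 < q.toReal := ENNReal.toReal_pos hq.ne' hqt
    simp [lorentzNorm, hqt, hv, hq0, ENNReal.zero_rpow_of_pos (div_pos hq0 hp)]

/-- |f| agrees a.e. with a measurable function, and null sets affect neither averages nor
w-distribution functions. -/
lemma maximalOpNorm_le {B : ℝ≥0∞}
    (h : ∀ g : (Fin n → ℝ) → ℝ≥0∞, Measurable g →
      lorentzNorm p q v (maximal g) ≤ B * lorentzNorm p q w g) :
    maximalOpNorm p q w v ≤ B := by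
  refine iSup_le fun f => iSup_le fun hf => iSup_le fun h0 => iSup_le fun htop => ?_
  have hfg := hf.enorm.ae_eq_mk
  rw [ENNReal.div_le_iff h0 htop, maximal_congr_enorm hfg, lorentzNorm_congr_enorm hfg]
  exact h _ hf.enorm.measurable_mk

/-- The dimensional constant. -/
noncomputable def dimConst (n : ℕ) : ℝ := 6 * (n + 3) ^ n * (gridCount n + 1)

lemma one_le_dimConst (n : ℕ) : 1 ≤ dimConst n := by
  have h1 : (1 : ℝ) ≤ (n + 3) ^ n := one_le_pow₀ (by
    have : (0 : ℝ) ≤ n := by positivity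
    linarith)
  have h2 : (0 : ℝ) ≤ gridCount n := by positivity
  rw [dimConst]
  nlinarith

/-- p - r = (p-1)δ/(1+δ), so p/(p-r) = p'(1 + 1/δ), and 1 + 1/δ ≤ 3(n+3)^n S. This accounts for 6 =
2 · 3 in `dimConst`. -/
lemma gridCount_mul_le {δ S : ℝ} (hp : 1 < p) (hS : 1 ≤ S)
    (hδ : δ = (2 * (n + 3) ^ n * S)⁻¹) (hr : r = 1 + (p - 1) / (1 + δ)) :
    gridCount n * (2 * (p / (p - r))) ≤ dimConst n * p.conjExponent * S := by
  have hM : (1 : ℝ) ≤ (n + 3) ^ n := one_le_pow₀ (by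
    have : (0 : ℝ) ≤ n := by positivity
    linarith)
  set M : ℝ := (n + 3) ^ n with hMdef
  have hp1 : 0 < p - 1 := by linarith
  have hδ0 : 0 < δ := by rw [hδ]; positivity
  have hpc : 0 < p.conjExponent := by rw [Real.conjExponent]; positivity
  have e : p / (p - r) = p.conjExponent * (1 + δ⁻¹) := by
    have : p - r = (p - 1) * δ / (1 + δ) := by
      rw [hr]
      field_simp
      ring
    rw [this, Real.conjExponent]
    field_simp
    ring
  have hle : 1 + δ⁻¹ ≤ 3 * (M * S) := by
    rw [hδ, inv_inv]
    nlinarith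
  rw [e, dimConst, ← hMdef]
  have hN : (0 : ℝ) ≤ gridCount n := by positivity
  calc gridCount n * (2 * (p.conjExponent * (1 + δ⁻¹)))
      ≤ (gridCount n + 1) * (2 * (p.conjExponent * (3 * (M * S)))) := by
        gcongr
        linarith
    _ = _ := by ring

/-- Since t ≤ 4 · 2^t, passing from c^{1/q} to the stated (4c/q)^{1/q} costs at most a factor 2. -/
lemma rpow_inv_le_two_mul {c t : ℝ} (hc : 0 ≤ c) (ht : 0 < t) :
    c ^ (1 / t) ≤ 2 * (4 * c / t) ^ (1 / t) := by
  have h1 : t ≤ 4 * 2 ^ t := by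
    have h := rpow_neg_self_le_two (inv_pos.2 ht)
    rw [inv_inv] at h
    have h2 := Real.rpow_le_rpow (by positivity) h ht.le
    rw [Real.rpow_inv_rpow ht.le ht.ne'] at h2
    have : (0 : ℝ) < 2 ^ t := by positivity
    linarith
  calc c ^ (1 / t) ≤ (2 ^ t * (4 * c / t)) ^ (1 / t) := by
        refine Real.rpow_le_rpow hc ?_ (by positivity)
        rw [mul_div_assoc', le_div_iff₀ ht]
        nlinarith
    _ = 2 * (4 * c / t) ^ (1 / t) := by
        rw [Real.mul_rpow (by positivity) (by positivity), ← Real.rpow_mul zero_le_two,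
          mul_one_div_cancel ht.ne', Real.rpow_one]

lemma six_rpow_mul_two_rpow_le (hp : 1 < p) (hrp : r ≤ p) :
    ((6 : ℝ≥0∞) ^ r * 2 ^ (p - 1)) ^ (1 / p) ≤ 12 := by
  have hp0 : 0 < p := by linarith
  calc ((6 : ℝ≥0∞) ^ r * 2 ^ (p - 1)) ^ (1 / p) ≤ (6 ^ p * 2 ^ p) ^ (1 / p) := by
        gcongr
        · norm_num
        · exact one_le_two
        · linarith
    _ = 12 := by
        rw [← ENNReal.mul_rpow_of_nonneg _ _ hp0.le, ← ENNReal.rpow_mul,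
          mul_one_div_cancel hp0.ne', ENNReal.rpow_one]
        norm_num

end Lorentz

end LorentzMaximal

/-! ### Assembly of the corollary. -/

open LorentzMaximal in
theorem corollary2p3 :
    ∃ (C : ℝ) (c : ℕ → ℝ), 0 < C ∧ (∀ n, 1 ≤ c n) ∧
      ∀ (n : ℕ), 0 < n → ∀ (p : ℝ), 1 < p → ∀ (q : ℝ≥0∞), 0 < q →
        ∀ (v w : (Fin n → ℝ) → ℝ≥0∞),
          LorentzMaximal.IsWeight v → LorentzMaximal.IsWeight w →
          LorentzMaximal.apConst p v w < ∞ →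
          LorentzMaximal.MemAInfty (LorentzMaximal.dualWeight p w) →
          (ENNReal.ofReal p ≤ q →
            LorentzMaximal.maximalOpNorm p q w v ≤
              ENNReal.ofReal (C * (c n * p.conjExponent)) *
                LorentzMaximal.apConst p v w ^ (1 / p) *
                LorentzMaximal.aInftyConst (LorentzMaximal.dualWeight p w) ^ (1 / p)) ∧
          (q ≤ ENNReal.ofReal p →
            LorentzMaximal.maximalOpNorm p q w v ≤
              ENNReal.ofReal (C * ((4 * c n / q.toReal) ^ (1 / q.toReal) *
                  p.conjExponent ^ (1 / q.toReal))) *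
                LorentzMaximal.apConst p v w ^ (1 / p) *
                LorentzMaximal.aInftyConst (LorentzMaximal.dualWeight p w) ^
                  (1 / q.toReal)) := by
  -- 48 = 2 · 12 · 2: the cut at s/2, `six_rpow_mul_two_rpow_le`, and `rpow_inv_le_two_mul`, the
  -- last only for q ≤ p.
  refine ⟨48, dimConst, by norm_num, one_le_dimConst, ?_⟩
  intro n hn p hp q hq v w _ hw hA hσ
  have hp0 : 0 < p := by linarith
  have hp1 : 0 < p - 1 := by linarith
  have hpc : 1 ≤ p.conjExponent := by
    rw [Real.conjExponent, one_le_div hp1]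
    linarith
  have hc1 := one_le_dimConst n
  set A := apConst p v w with hAdef
  set Aσ := aInftyConst (dualWeight p w) with hAσdef
  rcases eq_or_ne A 0 with hA0 | hA0
  · have h0 : maximalOpNorm p q w v ≤ 0 := maximalOpNorm_le fun g _ => by
      rw [lorentzNorm_eq_zero_of_withDensity_eq_zero hp0 hq
        (withDensity_eq_zero_of_apConst_eq_zero hσ hA0)]
      exact bot_le
    exact ⟨fun _ => h0.trans bot_le, fun _ => h0.trans bot_le⟩
  have hAp : A ^ (1 / p) ≠ 0 := (ENNReal.rpow_pos (pos_iff_ne_zero.2 hA0) hA.ne).ne'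
  -- As A ≠ 0, an infinite Aσ makes the right sides infinite.
  rcases eq_or_ne Aσ ∞ with hAσ | hAσ
  · constructor
    · intro _
      rw [hAσ, ENNReal.top_rpow_of_pos (by positivity), ENNReal.mul_top]
      · exact le_top
      · refine mul_ne_zero ?_ hAp
        rw [Ne, ENNReal.ofReal_eq_zero, not_le]
        positivity
    · intro hqp
      have hq0 : 0 < q.toReal :=
        ENNReal.toReal_pos hq.ne' (ne_top_of_le_ne_top ENNReal.ofReal_ne_top hqp)
      rw [hAσ, ENNReal.top_rpow_of_pos (by positivity), ENNReal.mul_top]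
      · exact le_top
      · refine mul_ne_zero ?_ hAp
        rw [Ne, ENNReal.ofReal_eq_zero, not_le]
        positivity
  -- the main case
  set S := Aσ.toReal with hS
  have hS1 : 1 ≤ S := by
    rw [hS, ← ENNReal.toReal_one]
    exact ENNReal.toReal_mono hAσ hσ.one_le_aInftyConst
  set δ : ℝ := (2 * (n + 3) ^ n * S)⁻¹ with hδ
  have hδ0 : 0 < δ := by positivity
  set r : ℝ := 1 + (p - 1) / (1 + δ) with hr
  have hr0 : 0 < r := by positivity
  have hrp : r < p := by
    have : (p - 1) / (1 + δ) < p - 1 := div_lt_self hp1 (by linarith)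
    linarith
  have hΛ0 : 0 ≤ p / (p - r) := div_nonneg hp0.le (by linarith)
  have hdist := fun (g : (Fin n → ℝ) → ℝ≥0∞) (hg : Measurable g) (s : ℝ) (hs : 0 < s) =>
    distribution_maximal_le (v := v) hn hp hw hσ hAσ hδ hr hr0 hg hs
  have hconst : (gridCount n : ℝ≥0∞) * ENNReal.ofReal (2 * (p / (p - r))) ≤
      ENNReal.ofReal (dimConst n * p.conjExponent) * Aσ := by
    rw [← ENNReal.ofReal_toReal hAσ, ← ENNReal.ofReal_natCast,
      ← ENNReal.ofReal_mul (by positivity), ← ENNReal.ofReal_mul (by positivity)]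
    exact ENNReal.ofReal_le_ofReal (gridCount_mul_le hp hS1 hδ hr)
  have h12 := six_rpow_mul_two_rpow_le hp hrp.le
  have hp' : 0 ≤ 1 / p := by positivity
  constructor
  · intro hpq
    refine maximalOpNorm_le fun g hg => ?_
    refine (lorentzNorm_maximal_le_of_le hr0 hrp hpq (hdist g hg)).trans ?_
    gcongr ?_ * _
    calc 2 * (gridCount n * 6 ^ r * 2 ^ (p - 1) * A * ENNReal.ofReal (p / (p - r))) ^ (1 / p)
        = 2 * ((6 ^ r * 2 ^ (p - 1)) * A *
            (gridCount n * ENNReal.ofReal (p / (p - r)))) ^ (1 / p) := by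
          congr 2
          ring
      _ ≤ 2 * ((6 ^ r * 2 ^ (p - 1)) * A *
            (ENNReal.ofReal (dimConst n * p.conjExponent) * Aσ)) ^ (1 / p) := by
          gcongr 2 * (_ * ?_) ^ (1 / p)
          refine le_trans ?_ hconst
          gcongr
          linarith
      _ = 2 * ((6 ^ r * 2 ^ (p - 1)) ^ (1 / p) * A ^ (1 / p) *
            (ENNReal.ofReal (dimConst n * p.conjExponent) ^ (1 / p) * Aσ ^ (1 / p))) := by
          simp only [ENNReal.mul_rpow_of_nonneg _ _ hp']
      _ ≤ 2 * (12 * A ^ (1 / p) *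
            (ENNReal.ofReal (dimConst n * p.conjExponent) * Aσ ^ (1 / p))) := by
          gcongr
          -- The base is at least 1 and 1/p ≤ 1, so the exponent can be raised to 1.
          conv_rhs => rw [← ENNReal.rpow_one (ENNReal.ofReal (dimConst n * p.conjExponent))]
          refine ENNReal.rpow_le_rpow_of_exponent_le ?_ ((div_le_one hp0).2 hp.le)
          rw [← ENNReal.ofReal_one]
          exact ENNReal.ofReal_le_ofReal (one_le_mul_of_one_le_of_one_le hc1 hpc)
      _ = 24 * ENNReal.ofReal (dimConst n * p.conjExponent) * A ^ (1 / p) * Aσ ^ (1 / p) := by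
          ring
      _ ≤ _ := by
          rw [ENNReal.ofReal_mul (by norm_num : (0 : ℝ) ≤ 48), ENNReal.ofReal_ofNat]
          gcongr
          norm_num
  · intro hqp
    have hqt : q ≠ ∞ := ne_top_of_le_ne_top ENNReal.ofReal_ne_top hqp
    have hq0 : 0 < q.toReal := ENNReal.toReal_pos hq.ne' hqt
    have hqp' : q.toReal ≤ p := ENNReal.toReal_le_of_le_ofReal hp0.le hqp
    have hq' : 0 ≤ 1 / q.toReal := by positivity
    have hcount : (1 : ℝ≥0∞) ≤ gridCount n := by
      have : 0 < gridCount n := by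
        rw [gridCount]
        positivity
      exact_mod_cast this
    refine maximalOpNorm_le fun g hg => ?_
    refine (lorentzNorm_maximal_le_of_ge hr0 hrp hq hqp (hdist g hg)).trans ?_
    gcongr ?_ * _
    calc 2 * (gridCount n * 6 ^ r * 2 ^ (p - 1) * A) ^ (1 / p) *
          ENNReal.ofReal (2 * (p / (p - r))) ^ (1 / q.toReal)
        = 2 * ((6 ^ r * 2 ^ (p - 1)) ^ (1 / p) * A ^ (1 / p)) * ((gridCount n : ℝ≥0∞) ^ (1 / p) *
          ENNReal.ofReal (2 * (p / (p - r))) ^ (1 / q.toReal)) := by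
          rw [show (gridCount n : ℝ≥0∞) * 6 ^ r * 2 ^ (p - 1) * A =
            gridCount n * ((6 ^ r * 2 ^ (p - 1)) * A) by ring,
            ENNReal.mul_rpow_of_nonneg _ _ hp', ENNReal.mul_rpow_of_nonneg _ A hp']
          ring
      _ ≤ 2 * (12 * A ^ (1 / p)) * ((gridCount n : ℝ≥0∞) ^ (1 / q.toReal) *
          ENNReal.ofReal (2 * (p / (p - r))) ^ (1 / q.toReal)) := by
          -- Since q ≤ p and there is at least one grid, the count may take the larger power 1/q and
          -- merge with the Hardy mass.
          have := ENNReal.rpow_le_rpow_of_exponent_le hcount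
            (one_div_le_one_div_of_le hq0 hqp')
          gcongr
      _ ≤ 2 * (12 * A ^ (1 / p)) *
          (ENNReal.ofReal (dimConst n * p.conjExponent) * Aσ) ^ (1 / q.toReal) := by
          rw [← ENNReal.mul_rpow_of_nonneg _ _ hq']
          gcongr
      _ = 24 * ENNReal.ofReal (dimConst n ^ (1 / q.toReal) * p.conjExponent ^ (1 / q.toReal)) *
          A ^ (1 / p) * Aσ ^ (1 / q.toReal) := by
          rw [ENNReal.mul_rpow_of_nonneg _ _ hq', ENNReal.ofReal_rpow_of_nonneg (by positivity) hq',
            Real.mul_rpow (by positivity) (by positivity)]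
          ring
      _ ≤ _ := by
          gcongr
          rw [← ENNReal.ofReal_ofNat, ← ENNReal.ofReal_mul (by norm_num)]
          refine ENNReal.ofReal_le_ofReal ?_
          have h1 := rpow_inv_le_two_mul (zero_le_one.trans hc1) hq0
          calc (24 : ℝ) * (dimConst n ^ (1 / q.toReal) * p.conjExponent ^ (1 / q.toReal))
              ≤ 24 * ((2 * (4 * dimConst n / q.toReal) ^ (1 / q.toReal)) *
                p.conjExponent ^ (1 / q.toReal)) := by gcongr
            _ = _ := by ring
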